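/- A $P$-operator is a linear operator $A:L^\infty(\Omega)\to L^1(\Omega)$, $v\mapsto vA$, where $(\Omega,\mathcal A,\mu)$ is a probability space (and all functions are real-valued), such that $\|A\|_{\infty\to 1}<\infty$; here, for $p,q\in[1,\infty]$, $\|A\|_{p\to q}:=\sup_{0\ne v\in L^\infty(\Omega)}\|vA\|_q/\|v\|_p\in[0,\infty]$. For $k\ge 1$, the $k$-profile $\mathcal S_k(A)$ is the set of all joint distributions on $\mathbb R^{2k}$ of the form $\mathcal D(v_1,\dots,v_k,v_1A,\dots,v_kA)$, where $v_1,\dots,v_k$ run through the measurable functions on $\Omega$ with values in $[-1,1]$. Let $d_H$ be the Hausdorff distance of sets of Borel probability measures on $\mathbb R^{2k}$ with respect to the Lévy–Prokhorov metric (with the Euclidean distance on $\mathbb R^{2k}$), and for two $P$-operators $A,B$ (possibly on different probability spaces) let $$d_M(A,B):=\sum_{k=1}^\infty 2^{-k}\,d_H(\mathcal S_k(A),\mathcal S_k(B)).$$ $P$-operators $A,B$ are weakly equivalent if $d_M(A,B)=0$; then $d_M$ is a metric on the set $\mathcal X$ of weak equivalence classes. Let $\mathcal X'\subset\mathcal X$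 be the set of classes of $P$-operators defined on atomless probability spaces (those in which every measurable set of positive measure has a measurable subset of strictly smaller positive measure). For $c>0$, $p\in[1,\infty)$ and $q\in(1,\infty]$, let $\mathcal X_{p,q,c}$ be the set of classes of $P$-operators $A$ with $\|A\|_{p\to q}\le c$, and let $\mathcal X'_{p,q,c}:=\mathcal X'\cap\mathcal X_{p,q,c}$. **Theorem (Compactness).** For every real $c>0$, every $p\in[1,\infty)$ and every $q\in(1,\infty]$, the metric spaces $(\mathcal X_{p,q,c},d_M)$ and $(\mathcal X'_{p,q,c},d_M)$ are compact. -/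

import Mathlib

open MeasureTheory Set
open scoped ENNReal

universe u

noncomputable section

namespace ActionConv

section OperatorNorm

variable {Ω : Type u} [MeasurableSpace Ω] {μ : Measure Ω}

/-- The operator norm `‖T‖_{p → q} = sup_{v ∈ L^∞} ‖v T‖_q / ‖v‖_p`, with values in `[0, ∞]`, of a
linear operator `T : L^∞(Ω) → L^1(Ω)`. The term `v = 0` contributes `0 / 0 = 0`. -/
def opNorm (p q : ℝ≥0∞) (T : Lp ℝ ∞ μ →ₗ[ℝ] Lp ℝ 1 μ) : ℝ≥0∞ :=
  ⨆ v : Lp ℝ ∞ μ, eLpNorm (T v) q μ / eLpNorm v p μ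

end OperatorNorm

/-- A probability space is atomless if every measurable set of positive measure has a measurable
subset of strictly smaller positive measure. -/
def IsAtomless {Ω : Type u} [MeasurableSpace Ω] (μ : Measure Ω) : Prop :=
  ∀ s, MeasurableSet s → 0 < μ s → ∃ t, t ⊆ s ∧ MeasurableSet t ∧ 0 < μ t ∧ μ t < μ s

/-- A `P`-operator: a probability space `(Ω, μ)` together with a linear operator
`L^∞(Ω) → L^1(Ω)` with `‖·‖_{∞ → 1} < ∞`. -/
structure POperator : Type (u + 1) where
  Ω : Type u
  [mΩ : MeasurableSpace Ω]
  μ : ProbabilityMeasure Ω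
  op : Lp ℝ ∞ (μ : Measure Ω) →ₗ[ℝ] Lp ℝ 1 (μ : Measure Ω)
  bounded : opNorm ∞ 1 op < ∞

attribute [instance] POperator.mΩ

/-- `ℝ^{2k}` with its Euclidean metric; the first `k` coordinates are indexed by `Sum.inl`, the last
`k` coordinates by `Sum.inr`. -/
abbrev E (k : ℕ) : Type := EuclideanSpace ℝ (Fin k ⊕ Fin k)

/-- Borel probability measures on `ℝ^{2k}` with the Lévy-Prokhorov metric. -/
abbrev LPSpace (k : ℕ) : Type := LevyProkhorov (ProbabilityMeasure (E k))

namespace POperator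

/-- The norm `‖A‖_{p → q}` of a `P`-operator. -/
def norm (p q : ℝ≥0∞) (A : POperator.{u}) : ℝ≥0∞ := opNorm p q A.op

/-- A `P`-operator is atomless if its underlying probability space is. -/
def Atomless (A : POperator.{u}) : Prop := IsAtomless (A.μ : Measure A.Ω)

/-- The map `ω ↦ (v₁(ω), …, v_k(ω), (v₁A)(ω), …, (v_kA)(ω))`. -/
def jointMap (A : POperator.{u}) {k : ℕ} (v : Fin k → Lp ℝ ∞ (A.μ : Measure A.Ω)) (ω : A.Ω) : E k :=
  WithLp.toLp 2 (Sum.elim (fun i => v i ω) (fun i => A.op (v i) ω))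

theorem aemeasurable_jointMap (A : POperator.{u}) {k : ℕ}
    (v : Fin k → Lp ℝ ∞ (A.μ : Measure A.Ω)) :
    AEMeasurable (A.jointMap v) (A.μ : Measure A.Ω) := by
  refine (WithLp.measurable_toLp 2 (Fin k ⊕ Fin k → ℝ)).comp_aemeasurable ?_
  refine aemeasurable_pi_lambda _ ?_
  rintro (i | i)
  · exact (Lp.aestronglyMeasurable (v i)).aemeasurable
  · exact (Lp.aestronglyMeasurable (A.op (v i))).aemeasurable

/-- The joint distribution `D_A(v₁, …, v_k) = D(v₁, …, v_k, v₁A, …, v_kA)`. -/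
def jointLaw (A : POperator.{u}) {k : ℕ} (v : Fin k → Lp ℝ ∞ (A.μ : Measure A.Ω)) : LPSpace k :=
  LevyProkhorov.ofMeasure (A.μ.map (A.aemeasurable_jointMap v))

/-- The `k`-profile `S_k(A)`: all joint distributions `D_A(v₁, …, v_k)`, where `v₁, …, v_k` are
bounded measurable functions with values in `[-1, 1]`. -/
def profile (A : POperator.{u}) (k : ℕ) : Set (LPSpace k) :=
  {ν | ∃ v : Fin k → Lp ℝ ∞ (A.μ : Measure A.Ω),
    (∀ i, ∀ᵐ ω ∂(A.μ : Measure A.Ω), v i ω ∈ Icc (-1 : ℝ) 1) ∧ A.jointLaw v = ν}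

/-- `d_M(A, B) = ∑_{k ≥ 1} 2^{-k} d_H(S_k(A), S_k(B))`, where `d_H` is the Hausdorff distance of sets
of probability measures that comes from the Lévy-Prokhorov metric. -/
def dM (A B : POperator.{u}) : ℝ :=
  ∑' k : ℕ, (1 / 2 : ℝ) ^ (k + 1) * Metric.hausdorffDist (A.profile (k + 1)) (B.profile (k + 1))

theorem profile_nonempty (A : POperator.{u}) (k : ℕ) : (A.profile k).Nonempty := by
  refine ⟨_, fun _ => 0, fun i => ?_, rfl⟩
  filter_upwards [Lp.coeFn_zero ℝ ∞ (A.μ : Measure A.Ω)] with ω hω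
  rw [hω]
  norm_num

theorem edist_LPSpace_le_one {k : ℕ} (μ ν : LPSpace k) : edist μ ν ≤ 1 := by
  rw [LevyProkhorov.edist_probabilityMeasure_def]
  refine (levyProkhorovEDist_le_max_measure_univ _ _).trans ?_
  simp

theorem hausdorffEDist_profile_le_one (A B : POperator.{u}) (k : ℕ) :
    Metric.hausdorffEDist (A.profile k) (B.profile k) ≤ 1 := by
  obtain ⟨a, ha⟩ := A.profile_nonempty k
  obtain ⟨b, hb⟩ := B.profile_nonempty k
  exact Metric.hausdorffEDist_le_of_mem_edist
    (fun x _ => ⟨b, hb, edist_LPSpace_le_one x b⟩) (fun y _ => ⟨a, ha, edist_LPSpace_le_one y a⟩)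

theorem hausdorffEDist_profile_ne_top (A B : POperator.{u}) (k : ℕ) :
    Metric.hausdorffEDist (A.profile k) (B.profile k) ≠ ∞ :=
  ((hausdorffEDist_profile_le_one A B k).trans_lt ENNReal.one_lt_top).ne

theorem hausdorffDist_profile_le_one (A B : POperator.{u}) (k : ℕ) :
    Metric.hausdorffDist (A.profile k) (B.profile k) ≤ 1 := by
  rw [Metric.hausdorffDist]
  exact ENNReal.toReal_le_of_le_ofReal zero_le_one
    (by simpa using hausdorffEDist_profile_le_one A B k)

theorem summable_dM (A B : POperator.{u}) : Summable fun k : ℕ =>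
    (1 / 2 : ℝ) ^ (k + 1) * Metric.hausdorffDist (A.profile (k + 1)) (B.profile (k + 1)) := by
  have h : Summable fun k : ℕ => (1 / 2 : ℝ) ^ (k + 1) :=
    (summable_nat_add_iff 1).2 summable_geometric_two
  refine Summable.of_nonneg_of_le
    (fun k => mul_nonneg (by positivity) Metric.hausdorffDist_nonneg) (fun k => ?_) h
  exact mul_le_of_le_one_right (by positivity) (hausdorffDist_profile_le_one A B (k + 1))

theorem dM_self (A : POperator.{u}) : dM A A = 0 := by
  simp [dM, Metric.hausdorffDist_self_zero]

theorem dM_comm (A B : POperator.{u}) : dM A B = dM B A := by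
  simp only [dM, Metric.hausdorffDist_comm]

theorem dM_triangle (A B C : POperator.{u}) : dM A C ≤ dM A B + dM B C := by
  rw [dM, dM, dM, ← (summable_dM A B).tsum_add (summable_dM B C)]
  refine (summable_dM A C).tsum_le_tsum (fun k => ?_) ((summable_dM A B).add (summable_dM B C))
  rw [← mul_add]
  exact mul_le_mul_of_nonneg_left
    (Metric.hausdorffDist_triangle (hausdorffEDist_profile_ne_top A B (k + 1))) (by positivity)

/-- `P`-operators form a pseudometric space under `d_M`. -/
instance : PseudoMetricSpace POperator.{u} where
  dist := dM
  dist_self := dM_self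
  dist_comm := dM_comm
  dist_triangle := dM_triangle

end POperator

/-- The metric space `(X, d_M)` of weak equivalence classes of `P`-operators: the quotient of all
`P`-operators by the relation `d_M(A, B) = 0` (see `mk_eq_mk_iff`, `dist_mk`). -/
abbrev WeakClass : Type (u + 1) := SeparationQuotient POperator.{u}

namespace WeakClass

/-- The weak equivalence class of a `P`-operator. -/
abbrev mk (A : POperator.{u}) : WeakClass.{u} := SeparationQuotient.mk A

theorem mk_eq_mk_iff (A B : POperator.{u}) : mk A = mk B ↔ POperator.dM A B = 0 :=
  SeparationQuotient.mk_eq_mk.trans Metric.inseparable_iff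

theorem dist_mk (A B : POperator.{u}) : dist (mk A) (mk B) = POperator.dM A B := rfl

/-- `X_{p,q,c}`: the weak equivalence classes of `P`-operators `A` with `‖A‖_{p → q} ≤ c`. -/
def bounded (p q : ℝ≥0∞) (c : ℝ) : Set WeakClass.{u} :=
  {x | ∃ A : POperator.{u}, mk A = x ∧ A.norm p q ≤ ENNReal.ofReal c}

/-- The set of weak equivalence classes of `P`-operators on atomless probability spaces. -/
def atomless : Set WeakClass.{u} :=
  {x | ∃ A : POperator.{u}, mk A = x ∧ A.Atomless}

/-- The classes in `X_{p,q,c}` of `P`-operators on atomless probability spaces. -/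
def atomlessBounded (p q : ℝ≥0∞) (c : ℝ) : Set WeakClass.{u} :=
  atomless ∩ bounded p q c

end WeakClass

end ActionConv

end

noncomputable section

namespace ActionConv

open Filter Topology
open scoped NNReal BoundedContinuousFunction symmDiff

/-! Given `P`-operators `A n` on `Ω n` with ‖A n‖_{p→q} ≤ c, a limit is built along a nonprincipal
ultrafilter. The product of the `Ω n` carries the Loeb measure, under which an internal set has as
mass the ultralimit of the masses of its components. L¹-bounded sequences of functions have a.e.
finite pointwise ultralimits (`exists_isUltralim`), and every bounded function on the Loeb space
arises from a uniformly bounded sequence (`exists_lift`).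

The limit operator sends the ultralimit of `u n` to that of `(A n).op (u n)`. This is well defined
because p < ∞: a uniformly bounded sequence with ultralimit 0 has L^p norms tending to 0, and the
operators are uniformly bounded from L^p to L¹ (`exists_ultralim_op`).

Laws of ultralimits are ultralimits of laws (`IsUltralim.tendsto_map`), so the k-profiles converge
in Hausdorff distance (`exists_tendsto_hyperfilter`). The bound on ‖·‖_{p→q} is visible in the
1-profile and lower semicontinuous (`norm_le_of_tendsto_profile`), and atomlessness passes to Loeb
spaces (`isAtomless_loebMeasure`). Limits along the ultrafilter give sequential compactness. -/

/-- Countable saturation: a diagonal choice of indices along a filter finer than `atTop`. -/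
theorem exists_diagonal {l : Filter ℕ} (hl : l ≤ atTop) {Q : ℕ → ℕ → Prop}
    (hQ : ∀ k, ∀ᶠ n in l, Q k n) :
    ∃ κ : ℕ → ℕ, ∀ k, ∀ᶠ n in l, k ≤ κ n ∧ Q (κ n) n := by
  classical
  -- The largest k ≤ n for which `Q k n` holds; the default 0 is taken only when there is none,
  -- which eventually does not happen.
  refine ⟨fun n => Nat.findGreatest (fun k => Q k n) n, fun k => ?_⟩
  filter_upwards [hQ k, hl (eventually_ge_atTop k)] with n hn hkn
  exact ⟨Nat.le_findGreatest hkn hn, Nat.findGreatest_spec (P := fun k => Q k n) hkn hn⟩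

/-! ### Weak convergence and semicontinuity of norms -/

section WeakConvergence

/-- Layer-cake approximation: it compares the integral of a bounded nonnegative function, up to δ,
with the masses of finitely many superlevel sets. The saturated case y > Kδ only serves the
induction. -/
theorem staircase_bounds {δ y : ℝ} (hδ : 0 < δ) (hy : 0 ≤ y) (K : ℕ) :
    (K * δ < y → ∑ j ∈ Finset.range K, (if ((j + 1 : ℕ) : ℝ) * δ < y then δ else 0) = K * δ) ∧
    (y ≤ K * δ →
      y - δ ≤ ∑ j ∈ Finset.range K, (if ((j + 1 : ℕ) : ℝ) * δ < y then δ else 0) ∧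
      ∑ j ∈ Finset.range K, (if ((j + 1 : ℕ) : ℝ) * δ < y then δ else 0) ≤ y) := by
  induction K with
  | zero =>
    simp only [CharP.cast_eq_zero, zero_mul, Finset.range_zero, Finset.sum_empty, implies_true,
      true_and]
    intro h
    constructor <;> linarith
  | succ K ih =>
    rw [Finset.sum_range_succ]
    obtain ⟨h1, h2⟩ := ih
    have hK : ((K + 1 : ℕ) : ℝ) * δ = K * δ + δ := by push_cast; ring
    by_cases h : ((K + 1 : ℕ) : ℝ) * δ < y
    · rw [if_pos h, h1 (by linarith), ← hK]
      exact ⟨fun _ => rfl, fun h' => absurd h (not_lt.2 h')⟩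
    · rw [if_neg h, add_zero]
      refine ⟨fun h' => absurd h' h, fun _ => ?_⟩
      by_cases hy' : K * δ < y
      · rw [h1 hy']
        constructor <;> linarith [not_lt.1 h]
      · exact h2 (not_lt.1 hy')

/-- Portmanteau along an arbitrary filter: a lower bound for the masses of open sets implies weak
convergence. -/
theorem tendsto_of_forall_isOpen {ι E : Type*} [TopologicalSpace E] [MeasurableSpace E]
    [OpensMeasurableSpace E] {l : Filter ι} {ν : ι → ProbabilityMeasure E}
    {ν₀ : ProbabilityMeasure E}
    (h : ∀ G : Set E, IsOpen G → ∀ ε : ℝ, 0 < ε →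
      ∀ᶠ i in l, (ν₀ : Measure E).real G - ε ≤ (ν i : Measure E).real G) :
    Tendsto ν l (𝓝 ν₀) := by
  rcases eq_or_neBot l with rfl | hl
  · exact tendsto_bot
  rw [ProbabilityMeasure.tendsto_iff_forall_integral_tendsto]
  refine BoundedContinuousFunction.tendsto_integral_of_forall_integral_le_liminf_integral
    fun f hf => ?_
  refine le_of_forall_pos_le_add fun ε hε => ?_
  have hδ : 0 < ε / 2 := half_pos hε
  obtain ⟨K, hK⟩ := exists_nat_ge (‖f‖ / (ε / 2))
  have hfK : ∀ x, f x ≤ K * (ε / 2) := fun x =>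
    ((le_abs_self _).trans (f.norm_coe_le_norm x)).trans ((div_le_iff₀ hδ).1 hK)
  have hint : ∀ m : ProbabilityMeasure E,
      ∫ x, f x ∂(m : Measure E) - ε / 2 ≤
        ∑ j ∈ Finset.range K, (ε / 2) * (m : Measure E).real {x | ((j + 1 : ℕ) : ℝ) * (ε / 2) < f x}
      ∧ ∑ j ∈ Finset.range K,
        (ε / 2) * (m : Measure E).real {x | ((j + 1 : ℕ) : ℝ) * (ε / 2) < f x}
          ≤ ∫ x, f x ∂(m : Measure E) := by
    intro m
    have hmeas : ∀ j : ℕ, MeasurableSet {x | ((j + 1 : ℕ) : ℝ) * (ε / 2) < f x} := fun j =>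
      (isOpen_lt continuous_const f.continuous).measurableSet
    have hi : ∀ j : ℕ, Integrable (fun x => if ((j + 1 : ℕ) : ℝ) * (ε / 2) < f x then ε / 2 else 0)
        (m : Measure E) := fun j =>
      (integrable_const (ε / 2)).indicator (hmeas j)
    have hsum : ∑ j ∈ Finset.range K,
        (ε / 2) * (m : Measure E).real {x | ((j + 1 : ℕ) : ℝ) * (ε / 2) < f x}
        = ∫ x, ∑ j ∈ Finset.range K, (if ((j + 1 : ℕ) : ℝ) * (ε / 2) < f x then ε / 2 else 0)
          ∂(m : Measure E) := by
      rw [integral_finsetSum _ fun j _ => hi j]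
      refine Finset.sum_congr rfl fun j _ => ?_
      have := integral_indicator_const (μ := (m : Measure E)) (ε / 2) (hmeas j)
      rw [smul_eq_mul, mul_comm ((m : Measure E).real _)] at this
      rw [← this]
      rfl
    have hfi : Integrable f (m : Measure E) := f.integrable _
    rw [hsum]
    constructor
    · have : ∫ x, f x ∂(m : Measure E) - ε / 2 = ∫ x, (f x - ε / 2) ∂(m : Measure E) := by
        rw [integral_sub hfi (integrable_const _)]
        simp
      rw [this]
      exact integral_mono (hfi.sub (integrable_const _)) (integrable_finsetSum _ fun j _ => hi j)
        fun x => ((staircase_bounds hδ (hf x) K).2 (hfK x)).1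
    · exact integral_mono (integrable_finsetSum _ fun j _ => hi j) hfi
        fun x => ((staircase_bounds hδ (hf x) K).2 (hfK x)).2
  -- With tolerance 1/(K+1) per level, the K levels of height ε/2 lose at most ε/2 in total; the
  -- staircase loses the other ε/2.
  have hev : ∀ᶠ i in l, ∀ j ∈ Finset.range K,
      (ν₀ : Measure E).real {x | ((j + 1 : ℕ) : ℝ) * (ε / 2) < f x} - 1 / (K + 1) ≤
        (ν i : Measure E).real {x | ((j + 1 : ℕ) : ℝ) * (ε / 2) < f x} :=
    (eventually_all_finset _).2 fun j _ =>
      h _ (isOpen_lt continuous_const f.continuous) _ (by positivity)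
  have hbdd : IsCoboundedUnder (· ≥ ·) l fun i => ∫ x, f x ∂(ν i : Measure E) := by
    refine IsBoundedUnder.isCoboundedUnder_ge ⟨‖f‖, eventually_map.2 (Eventually.of_forall ?_)⟩
    intro i
    refine (le_abs_self _).trans ?_
    simpa using f.norm_integral_le_norm (ν i : Measure E)
  rw [← sub_le_iff_le_add]
  refine le_liminf_of_le hbdd ?_
  filter_upwards [hev] with i hi
  have h1 := (hint ν₀).1
  have h2 := (hint (ν i)).2
  have h3 : ∑ j ∈ Finset.range K,
        (ε / 2) * ((ν₀ : Measure E).real {x | ((j + 1 : ℕ) : ℝ) * (ε / 2) < f x} - 1 / (K + 1)) ≤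
      ∑ j ∈ Finset.range K,
        (ε / 2) * (ν i : Measure E).real {x | ((j + 1 : ℕ) : ℝ) * (ε / 2) < f x} :=
    Finset.sum_le_sum fun j hj => mul_le_mul_of_nonneg_left (hi j hj) hδ.le
  simp only [mul_sub, Finset.sum_sub_distrib, Finset.sum_const, Finset.card_range,
    nsmul_eq_mul] at h3
  have h4 : (K : ℝ) * (ε / 2 * (1 / (K + 1))) ≤ ε / 2 := by
    rw [show (K : ℝ) * (ε / 2 * (1 / (K + 1))) = (K / (K + 1)) * (ε / 2) by ring]
    refine mul_le_of_le_one_left hδ.le ?_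
    rw [div_le_one (by positivity)]
    linarith
  linarith

variable {ι E : Type*} [TopologicalSpace E] [MeasurableSpace E] [OpensMeasurableSpace E]
  {l : Filter ι} {ν : ι → ProbabilityMeasure E} {ν₀ : ProbabilityMeasure E}

/-- Under weak convergence, the integrals of a continuous nonnegative function are lower
semicontinuous. -/
theorem lintegral_le_of_tendsto [l.NeBot] (h : Tendsto ν l (𝓝 ν₀)) {f : E → ℝ≥0}
    (hf : Continuous f) {C : ι → ℝ≥0∞} {C₀ : ℝ≥0∞}
    (hC : ∀ i, ∫⁻ x, f x ∂(ν i : Measure E) ≤ C i) (hC₀ : Tendsto C l (𝓝 C₀)) :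
    ∫⁻ x, f x ∂(ν₀ : Measure E) ≤ C₀ := by
  -- Truncation at N yields bounded continuous test functions; monotone convergence removes it.
  have hsup : ∀ x, (f x : ℝ≥0∞) = ⨆ N : ℕ, ((min (f x) N : ℝ≥0) : ℝ≥0∞) := by
    intro x
    refine le_antisymm ?_ (iSup_le fun N => by exact_mod_cast min_le_left _ _)
    obtain ⟨N, hN⟩ := exists_nat_ge (f x)
    exact le_iSup_of_le N (by rw [min_eq_left hN])
  simp_rw [hsup]
  rw [lintegral_iSup]
  · refine iSup_le fun N => ?_
    let g : E →ᵇ ℝ≥0 := BoundedContinuousFunction.mkOfBound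
      ⟨fun x => min (f x) N, hf.min continuous_const⟩ N (by
        intro x y
        rw [NNReal.dist_eq, abs_le]
        have h1 : ((min (f x) N : ℝ≥0) : ℝ) ≤ N := by exact_mod_cast min_le_right _ _
        have h2 : ((min (f y) N : ℝ≥0) : ℝ) ≤ N := by exact_mod_cast min_le_right _ _
        have h3 : (0 : ℝ) ≤ (min (f x) N : ℝ≥0) := NNReal.coe_nonneg _
        have h4 : (0 : ℝ) ≤ (min (f y) N : ℝ≥0) := NNReal.coe_nonneg _
        simp only [ContinuousMap.coe_mk]
        constructor <;> linarith)
    have hg := ProbabilityMeasure.tendsto_iff_forall_lintegral_tendsto.1 h g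
    refine le_of_tendsto_of_tendsto' hg hC₀ fun i => le_trans (lintegral_mono fun x => ?_) (hC i)
    exact ENNReal.coe_le_coe.2 (min_le_left _ _)
  · intro N
    exact (measurable_coe_nnreal_ennreal.comp (hf.min continuous_const).measurable)
  · intro a b hab x
    exact ENNReal.coe_le_coe.2 (min_le_min le_rfl (by exact_mod_cast hab))

/-- Under weak convergence, an `L^q` norm of a continuous function is lower semicontinuous. -/
theorem eLpNorm_le_of_tendsto [HasOuterApproxClosed E] [l.NeBot] (h : Tendsto ν l (𝓝 ν₀)) {φ : E → ℝ} (hφ : Continuous φ)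
    {q : ℝ≥0∞} {C : ι → ℝ≥0∞} {C₀ : ℝ≥0∞}
    (hC : ∀ i, eLpNorm φ q (ν i : Measure E) ≤ C i) (hC₀ : Tendsto C l (𝓝 C₀)) :
    eLpNorm φ q (ν₀ : Measure E) ≤ C₀ := by
  rcases eq_or_ne q 0 with rfl | hq0
  · simp
  rcases eq_or_ne q ∞ with rfl | hq
  · refine le_of_forall_gt_imp_ge_of_dense fun D hD => ?_
    -- For D above the limiting bound this open set is eventually null, and the portmanteau
    -- inequality makes it null in the limit.
    have hG : IsOpen {x | D < ‖φ x‖ₑ} := isOpen_lt continuous_const hφ.enorm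
    have h0 : (ν₀ : Measure E) {x | D < ‖φ x‖ₑ} ≤ 0 := by
      refine (ProbabilityMeasure.le_liminf_measure_open_of_tendsto h hG).trans ?_
      refine (liminf_congr ?_).le.trans (liminf_const (f := l) (0 : ℝ≥0∞)).le
      filter_upwards [hC₀.eventually_lt_const hD] with i hi
      have := (eLpNorm_exponent_top (f := φ) (μ := (ν i : Measure E))) ▸ (hC i).trans_lt hi
      exact measure_mono_null (fun x hx => (this.trans hx :)) (meas_eLpNormEssSup_lt (f := φ))
    rw [eLpNorm_exponent_top]
    refine essSup_le_of_ae_le _ ?_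
    rw [nonpos_iff_eq_zero] at h0
    filter_upwards [measure_eq_zero_iff_ae_notMem.1 h0] with x hx
    exact not_lt.1 hx
  · have hq' : 0 < q.toReal := ENNReal.toReal_pos hq0 hq
    have hrw : ∀ m : Measure E, eLpNorm φ q m ^ q.toReal
        = ∫⁻ x, ((‖φ x‖₊ ^ q.toReal : ℝ≥0) : ℝ≥0∞) ∂m := by
      intro m
      rw [eLpNorm_eq_lintegral_rpow_enorm_toReal hq0 hq, ← ENNReal.rpow_mul,
        one_div_mul_cancel hq'.ne', ENNReal.rpow_one]
      refine lintegral_congr fun x => ?_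
      rw [ENNReal.coe_rpow_of_nonneg _ hq'.le]
      rfl
    rw [← ENNReal.rpow_le_rpow_iff hq', hrw]
    refine lintegral_le_of_tendsto h ((NNReal.continuous_rpow_const hq'.le).comp hφ.nnnorm)
      (fun i => ?_) (((ENNReal.continuous_rpow_const).tendsto C₀).comp hC₀)
    exact (hrw (ν i)).ge.trans (ENNReal.rpow_le_rpow (hC i) hq'.le)

/-- Under weak convergence, the `L^p` norms of a uniformly bounded continuous function converge. -/
theorem tendsto_eLpNorm_of_tendsto (h : Tendsto ν l (𝓝 ν₀)) {φ : E → ℝ} (hφ : Continuous φ)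
    {p : ℝ≥0∞} (hp0 : p ≠ 0) (hp : p ≠ ∞) {M : ℝ}
    (hM : ∀ i, ∀ᵐ x ∂(ν i : Measure E), |φ x| ≤ M) (hM₀ : ∀ᵐ x ∂(ν₀ : Measure E), |φ x| ≤ M) :
    Tendsto (fun i => eLpNorm φ p (ν i : Measure E)) l (𝓝 (eLpNorm φ p (ν₀ : Measure E))) := by
  have hp' : 0 < p.toReal := ENNReal.toReal_pos hp0 hp
  -- Truncation at M makes |φ|^p a bounded test function without changing it almost everywhere.
  let g : E →ᵇ ℝ≥0 := BoundedContinuousFunction.mkOfBound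
      ⟨fun x => (min ‖φ x‖₊ M.toNNReal) ^ p.toReal,
        (NNReal.continuous_rpow_const hp'.le).comp (hφ.nnnorm.min continuous_const)⟩
      (M.toNNReal ^ p.toReal : ℝ≥0) (by
        intro x y
        have hb : ∀ x, ((min ‖φ x‖₊ M.toNNReal) ^ p.toReal : ℝ≥0) ≤ M.toNNReal ^ p.toReal :=
          fun x => NNReal.rpow_le_rpow (min_le_right _ _) hp'.le
        have h1 := NNReal.coe_le_coe.2 (hb x)
        have h2 := NNReal.coe_le_coe.2 (hb y)
        have h3 := NNReal.coe_nonneg ((min ‖φ x‖₊ M.toNNReal) ^ p.toReal)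
        have h4 := NNReal.coe_nonneg ((min ‖φ y‖₊ M.toNNReal) ^ p.toReal)
        rw [NNReal.dist_eq, abs_le]
        simp only [ContinuousMap.coe_mk]
        constructor <;> linarith)
  have key : ∀ m : Measure E, (∀ᵐ x ∂m, |φ x| ≤ M) →
      eLpNorm φ p m = (∫⁻ x, g x ∂m) ^ (1 / p.toReal) := by
    intro m hm
    rw [eLpNorm_eq_lintegral_rpow_enorm_toReal hp0 hp]
    congr 1
    refine lintegral_congr_ae ?_
    filter_upwards [hm] with x hx
    have : min ‖φ x‖₊ M.toNNReal = ‖φ x‖₊ := by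
      refine min_eq_left ?_
      rw [← NNReal.coe_le_coe]
      exact hx.trans (Real.le_coe_toNNReal M)
    change ‖φ x‖ₑ ^ p.toReal = (((min ‖φ x‖₊ M.toNNReal) ^ p.toReal : ℝ≥0) : ℝ≥0∞)
    rw [this, ENNReal.coe_rpow_of_nonneg _ hp'.le]
    rfl
  rw [key _ hM₀]
  simp_rw [fun i => key _ (hM i)]
  exact ((ENNReal.continuous_rpow_const).tendsto _).comp
    (ProbabilityMeasure.tendsto_iff_forall_lintegral_tendsto.1 h g)

end WeakConvergence

-- Internal sets and the Loeb measure

local notation "𝒰" => (hyperfilter ℕ : Filter ℕ)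

section

theorem hyperfilter_le_atTop : 𝒰 ≤ atTop := by
  rw [← Nat.cofinite_eq_atTop]
  exact hyperfilter_le_cofinite

/-- The underlying set of the Loeb space of a sequence of measurable spaces. Sequences are not
identified modulo the ultrafilter: the measurable sets do not distinguish them anyway. -/
def LoebSpace (Ω : ℕ → Type u) : Type u := ∀ n, Ω n

variable {Ω : ℕ → Type u}

/-- The internal set given by a sequence of sets. -/
def internal (S : ∀ n, Set (Ω n)) : Set (LoebSpace Ω) := {x | ∀ᶠ n in 𝒰, x n ∈ S n}

theorem mem_internal {S : ∀ n, Set (Ω n)} {x : LoebSpace Ω} :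
    x ∈ internal S ↔ ∀ᶠ n in 𝒰, x n ∈ S n := Iff.rfl

theorem internal_compl (S : ∀ n, Set (Ω n)) : (internal S)ᶜ = internal fun n => (S n)ᶜ := by
  ext x
  exact Ultrafilter.eventually_not.symm

theorem internal_union (S T : ∀ n, Set (Ω n)) :
    internal S ∪ internal T = internal fun n => S n ∪ T n := by
  ext x
  exact Ultrafilter.eventually_or.symm

theorem internal_inter (S T : ∀ n, Set (Ω n)) :
    internal S ∩ internal T = internal fun n => S n ∩ T n := by
  ext x
  exact eventually_and.symm

theorem internal_univ : internal (fun n => (univ : Set (Ω n))) = univ := by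
  ext x
  simp [mem_internal]

theorem internal_empty : internal (fun n => (∅ : Set (Ω n))) = ∅ := by
  ext x
  simpa [mem_internal] using (inferInstance : NeBot 𝒰).ne

theorem internal_mono_of_eventually {S T : ∀ n, Set (Ω n)} (h : ∀ᶠ n in 𝒰, S n ⊆ T n) :
    internal S ⊆ internal T := by
  intro x hx
  filter_upwards [h, hx] with n hn hxn using hn hxn

/-- Otherwise points chosen in `S n \ T n` form an element of `internal S` outside `internal T`.
Hence an internal set determines its components for almost all n. -/
theorem eventually_subset_of_internal_subset [∀ n, Nonempty (Ω n)] {S T : ∀ n, Set (Ω n)}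
    (h : internal S ⊆ internal T) : ∀ᶠ n in 𝒰, S n ⊆ T n := by
  classical
  by_contra hST
  rw [← Ultrafilter.eventually_not] at hST
  let x : LoebSpace Ω := fun n =>
    if hn : (S n \ T n).Nonempty then hn.some else Classical.arbitrary (Ω n)
  have hx : ∀ᶠ n in 𝒰, x n ∈ S n \ T n := by
    filter_upwards [hST] with n hn
    have hn' : (S n \ T n).Nonempty := Set.sdiff_nonempty.2 hn
    simp only [x, dif_pos hn']
    exact hn'.some_mem
  have h1 : x ∈ internal S := hx.mono fun n hn => hn.1
  have h2 : x ∈ (internal T)ᶜ := by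
    rw [internal_compl]
    exact hx.mono fun n hn => hn.2
  exact h2 (h h1)

/-- An internal set covered by countably many internal sets is covered by finitely many of them. -/
theorem exists_finite_subcover_of_internal [∀ n, Nonempty (Ω n)] {S : ∀ n, Set (Ω n)}
    {T : ℕ → ∀ n, Set (Ω n)} (h : internal S ⊆ ⋃ i, internal (T i)) :
    ∃ N, internal S ⊆ ⋃ i ∈ Finset.range N, internal (T i) := by
  classical
  by_contra! hN
  have hQ : ∀ k, ∀ᶠ n in 𝒰, (S n \ ⋃ i ∈ Finset.range k, T i n).Nonempty := by
    intro k
    obtain ⟨x, hxS, hx⟩ := not_subset.1 (hN k)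
    have : ∀ᶠ n in 𝒰, ∀ i ∈ Finset.range k, x n ∉ T i n := by
      refine (eventually_all_finset _).2 fun i hi => ?_
      have : x ∈ (internal (T i))ᶜ := fun hxi => hx (mem_biUnion hi hxi)
      rwa [internal_compl] at this
    filter_upwards [hxS, this] with n h1 h2
    refine ⟨x n, h1, ?_⟩
    simpa using h2
  -- Since κ tends to infinity along 𝒰, a point avoiding the first `κ n` sets at each n eventually
  -- avoids every fixed `T i`.
  obtain ⟨κ, hκ⟩ := exists_diagonal hyperfilter_le_atTop hQ
  let x : LoebSpace Ω := fun n =>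
    if hn : (S n \ ⋃ i ∈ Finset.range (κ n), T i n).Nonempty then hn.some
      else Classical.arbitrary (Ω n)
  have hx : ∀ k, ∀ᶠ n in 𝒰, k ≤ κ n ∧ x n ∈ S n \ ⋃ i ∈ Finset.range (κ n), T i n := by
    intro k
    filter_upwards [hκ k] with n hn
    refine ⟨hn.1, ?_⟩
    simp only [x, dif_pos hn.2]
    exact hn.2.some_mem
  have hxS : x ∈ internal S := (hx 0).mono fun n hn => hn.2.1
  obtain ⟨i, hi⟩ := mem_iUnion.1 (h hxS)
  have hx' : x ∈ (internal (T i))ᶜ := by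
    rw [internal_compl]
    refine (hx (i + 1)).mono fun n hn hxn => hn.2.2 ?_
    exact mem_biUnion (Finset.mem_coe.2 (Finset.mem_range.2 hn.1)) hxn
  exact hx' hi

variable [∀ n, MeasurableSpace (Ω n)]

variable (Ω) in
/-- The algebra of internal measurable sets. -/
def internalAlgebra : Set (Set (LoebSpace Ω)) :=
  {s | ∃ S : ∀ n, Set (Ω n), (∀ n, MeasurableSet (S n)) ∧ internal S = s}

instance : MeasurableSpace (LoebSpace Ω) := MeasurableSpace.generateFrom (internalAlgebra Ω)

theorem measurableSet_internal {S : ∀ n, Set (Ω n)} (hS : ∀ n, MeasurableSet (S n)) :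
    MeasurableSet (internal S) := MeasurableSpace.measurableSet_generateFrom ⟨S, hS, rfl⟩

theorem isSetAlgebra_internalAlgebra : IsSetAlgebra (internalAlgebra Ω) where
  empty_mem := ⟨_, fun _ => MeasurableSet.empty, internal_empty⟩
  compl_mem := by
    rintro _ ⟨S, hS, rfl⟩
    exact ⟨_, fun n => (hS n).compl, (internal_compl S).symm⟩
  union_mem := by
    rintro _ _ ⟨S, hS, rfl⟩ ⟨T, hT, rfl⟩
    exact ⟨_, fun n => (hS n).union (hT n), (internal_union S T).symm⟩

variable (μ : ∀ n, ProbabilityMeasure (Ω n))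

open Classical in
/-- The ultralimit of the measures of an internal set. -/
def ultralimMass (s : Set (LoebSpace Ω)) : ℝ≥0∞ :=
  if h : s ∈ internalAlgebra Ω then
    (Ultrafilter.map (fun n => (μ n : Measure (Ω n)) (h.choose n)) (hyperfilter ℕ)).lim
  else 0

theorem nonempty_of_probabilityMeasure (μ : ∀ n, ProbabilityMeasure (Ω n)) (n : ℕ) : Nonempty (Ω n) := (μ n).nonempty

/-- The limit exists by compactness of [0, ∞], and the representative picked by `choose` agrees with
`S` for almost all n. -/
theorem tendsto_ultralimMass {S : ∀ n, Set (Ω n)} (hS : ∀ n, MeasurableSet (S n)) :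
    Tendsto (fun n => (μ n : Measure (Ω n)) (S n)) 𝒰 (𝓝 (ultralimMass μ (internal S))) := by
  have := nonempty_of_probabilityMeasure μ
  have h : internal S ∈ internalAlgebra Ω := ⟨S, hS, rfl⟩
  have heq : internal h.choose = internal S := h.choose_spec.2
  rw [ultralimMass, dif_pos h]
  have hlim : Tendsto (fun n => (μ n : Measure (Ω n)) (h.choose n)) 𝒰 (𝓝 _) :=
    (Ultrafilter.map (fun n => (μ n : Measure (Ω n)) (h.choose n)) (hyperfilter ℕ)).le_nhds_lim
  refine hlim.congr' ?_
  filter_upwards [eventually_subset_of_internal_subset heq.le,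
    eventually_subset_of_internal_subset heq.ge] with n h1 h2
  rw [subset_antisymm h1 h2]

/-- The finitely additive ultralimit content on the algebra of internal sets. -/
def ultralimContent : AddContent ℝ≥0∞ (internalAlgebra Ω) :=
  isSetAlgebra_internalAlgebra.isSetRing.addContent_of_union (ultralimMass μ)
    (by
      have h := tendsto_ultralimMass μ (fun n => (MeasurableSet.empty : MeasurableSet (∅ : Set (Ω n))))
      rw [internal_empty] at h
      simp only [measure_empty] at h
      exact (tendsto_nhds_unique tendsto_const_nhds h).symm)
    (by
      have := nonempty_of_probabilityMeasure μ
      rintro _ _ ⟨S, hS, rfl⟩ ⟨T, hT, rfl⟩ hST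
      have hdisj : ∀ᶠ n in 𝒰, Disjoint (S n) (T n) := by
        have : internal (fun n => S n ∩ T n) ⊆ internal fun n => (∅ : Set (Ω n)) := by
          rw [← internal_inter, hST.inter_eq, internal_empty]
        filter_upwards [eventually_subset_of_internal_subset this] with n hn
        exact disjoint_iff_inter_eq_empty.2 (subset_empty_iff.1 hn)
      have h1 := (tendsto_ultralimMass μ hS).add (tendsto_ultralimMass μ hT)
      have h2 := tendsto_ultralimMass μ fun n => (hS n).union (hT n)
      rw [internal_union]
      refine tendsto_nhds_unique h2 (h1.congr' ?_)
      filter_upwards [hdisj] with n hn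
      rw [measure_union hn (hT n)])

/-- By saturation, an internal countable union of internal sets is already a finite union, so finite
subadditivity suffices. -/
theorem isSigmaSubadditive_ultralimContent : (ultralimContent μ).IsSigmaSubadditive := by
  have := nonempty_of_probabilityMeasure μ
  intro f hf hfU
  choose T hT hTf using hf
  obtain ⟨S, hS, hSf⟩ := id hfU
  have hsub : internal S ⊆ ⋃ i, internal (T i) := by
    rw [hSf]
    exact iUnion_mono fun i => (hTf i).ge
  obtain ⟨N, hN⟩ := exists_finite_subcover_of_internal hsub
  have heq : ⋃ i, f i = ⋃ i ∈ Finset.range N, f i := by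
    refine subset_antisymm ?_ (iUnion₂_subset fun i _ => subset_iUnion f i)
    rw [← hSf]
    simpa only [hTf] using hN
  have hring := (isSetAlgebra_internalAlgebra (Ω := Ω)).isSetRing
  rw [heq]
  exact (addContent_biUnion_le hring fun i _ => ⟨T i, hT i, hTf i⟩).trans
    (ENNReal.sum_le_tsum _)

/-- The Loeb measure. -/
def loebMeasure : Measure (LoebSpace Ω) :=
  (ultralimContent μ).measure isSetAlgebra_internalAlgebra.isSetRing.isSetSemiring le_rfl
    (isSigmaSubadditive_ultralimContent μ)

theorem tendsto_loebMeasure {S : ∀ n, Set (Ω n)} (hS : ∀ n, MeasurableSet (S n)) :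
    Tendsto (fun n => (μ n : Measure (Ω n)) (S n)) 𝒰 (𝓝 (loebMeasure μ (internal S))) := by
  have : loebMeasure μ (internal S) = ultralimMass μ (internal S) :=
    (ultralimContent μ).measure_eq isSetAlgebra_internalAlgebra.isSetRing.isSetSemiring rfl
      (isSigmaSubadditive_ultralimContent μ) ⟨S, hS, rfl⟩
  rw [this]
  exact tendsto_ultralimMass μ hS

instance : IsProbabilityMeasure (loebMeasure μ) := by
  constructor
  have h := tendsto_loebMeasure μ (fun n => (MeasurableSet.univ : MeasurableSet (univ : Set (Ω n))))
  simp only [measure_univ, internal_univ] at h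
  exact (tendsto_nhds_unique tendsto_const_nhds h).symm

/-- The exceptional sets have measurable null hulls, and the internal set of these hulls has Loeb
measure lim 0 = 0. -/
theorem ae_eventually_of_forall_ae {p : ∀ n, Ω n → Prop}
    (h : ∀ n, ∀ᵐ ω ∂(μ n : Measure (Ω n)), p n ω) :
    ∀ᵐ x ∂(loebMeasure μ), ∀ᶠ n in 𝒰, p n (x n) := by
  have hz : ∀ n, (μ n : Measure (Ω n)) (toMeasurable (μ n : Measure (Ω n)) {ω | ¬ p n ω}) = 0 :=
    fun n => by rw [measure_toMeasurable]; exact h n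
  have h0 := tendsto_loebMeasure μ fun n =>
    measurableSet_toMeasurable (μ n : Measure (Ω n)) {ω | ¬ p n ω}
  simp only [hz] at h0
  have h1 := (tendsto_nhds_unique tendsto_const_nhds h0).symm
  filter_upwards [measure_eq_zero_iff_ae_notMem.1 h1] with x hx
  have : x ∈ (internal fun n => toMeasurable (μ n : Measure (Ω n)) {ω | ¬ p n ω})ᶜ := hx
  rw [internal_compl] at this
  filter_upwards [this] with n hn
  by_contra hp
  exact hn (subset_toMeasurable _ _ hp)

end

/-! ### Pointwise ultralimits of functions -/

section

variable {Ω : ℕ → Type u} [∀ n, MeasurableSpace (Ω n)] (μ : ∀ n, ProbabilityMeasure (Ω n))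

/-- `X₀` is almost everywhere the pointwise ultralimit of the sequence `X`. -/
def IsUltralim {E : Type*} [TopologicalSpace E] (X : ∀ n, Ω n → E) (X₀ : LoebSpace Ω → E) : Prop :=
  ∀ᵐ x ∂(loebMeasure μ), Tendsto (fun n => X n (x n)) 𝒰 (𝓝 (X₀ x))

variable {μ}

theorem IsUltralim.ae_eq {E : Type*} [TopologicalSpace E] [T2Space E] {X : ∀ n, Ω n → E}
    {X₀ X₁ : LoebSpace Ω → E} (h₀ : IsUltralim μ X X₀) (h₁ : IsUltralim μ X X₁) :
    X₀ =ᵐ[loebMeasure μ] X₁ := by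
  filter_upwards [h₀, h₁] with x h h' using tendsto_nhds_unique h h'

theorem IsUltralim.congr_right {E : Type*} [TopologicalSpace E] {X : ∀ n, Ω n → E}
    {X₀ X₁ : LoebSpace Ω → E} (h₀ : IsUltralim μ X X₀) (h : X₀ =ᵐ[loebMeasure μ] X₁) :
    IsUltralim μ X X₁ := by
  filter_upwards [h₀, h] with x h h'
  rwa [← h']

theorem IsUltralim.congr_left {E : Type*} [TopologicalSpace E] {X Y : ∀ n, Ω n → E}
    {X₀ : LoebSpace Ω → E} (h₀ : IsUltralim μ X X₀)
    (h : ∀ n, X n =ᵐ[(μ n : Measure (Ω n))] Y n) : IsUltralim μ Y X₀ := by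
  filter_upwards [h₀, ae_eventually_of_forall_ae μ h] with x h h'
  exact h.congr' h'

theorem IsUltralim.ae_mem {E : Type*} [TopologicalSpace E] {X : ∀ n, Ω n → E}
    {X₀ : LoebSpace Ω → E} (h₀ : IsUltralim μ X X₀) {F : Set E} (hF : IsClosed F)
    (h : ∀ n, ∀ᵐ ω ∂(μ n : Measure (Ω n)), X n ω ∈ F) : ∀ᵐ x ∂(loebMeasure μ), X₀ x ∈ F := by
  filter_upwards [h₀, ae_eventually_of_forall_ae μ h] with x h h'
  exact hF.mem_of_tendsto h h'

theorem IsUltralim.comp {E E' : Type*} [TopologicalSpace E] [TopologicalSpace E']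
    {X : ∀ n, Ω n → E} {X₀ : LoebSpace Ω → E} (h₀ : IsUltralim μ X X₀) {φ : E → E'}
    (hφ : Continuous φ) : IsUltralim μ (fun n ω => φ (X n ω)) fun x => φ (X₀ x) := by
  filter_upwards [h₀] with x h using (hφ.tendsto _).comp h

theorem IsUltralim.add {X Y : ∀ n, Ω n → ℝ} {X₀ Y₀ : LoebSpace Ω → ℝ} (hX : IsUltralim μ X X₀)
    (hY : IsUltralim μ Y Y₀) : IsUltralim μ (fun n => X n + Y n) (X₀ + Y₀) := by
  filter_upwards [hX, hY] with x h h' using h.add h'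

theorem IsUltralim.sub {X Y : ∀ n, Ω n → ℝ} {X₀ Y₀ : LoebSpace Ω → ℝ} (hX : IsUltralim μ X X₀)
    (hY : IsUltralim μ Y Y₀) : IsUltralim μ (fun n => X n - Y n) (X₀ - Y₀) := by
  filter_upwards [hX, hY] with x h h' using h.sub h'

theorem IsUltralim.const_smul {X : ∀ n, Ω n → ℝ} {X₀ : LoebSpace Ω → ℝ} (hX : IsUltralim μ X X₀)
    (c : ℝ) : IsUltralim μ (fun n => c • X n) (c • X₀) := by
  filter_upwards [hX] with x h using h.const_smul c

/-- The law of an ultralimit is the ultralimit of the laws. -/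
theorem IsUltralim.tendsto_map {E : Type*} [TopologicalSpace E] [MeasurableSpace E]
    [OpensMeasurableSpace E] {X : ∀ n, Ω n → E} {X₀ : LoebSpace Ω → E} (h : IsUltralim μ X X₀)
    (hX : ∀ n, Measurable (X n)) {ν : ℕ → ProbabilityMeasure E} {ν₀ : ProbabilityMeasure E}
    (hX₀ : AEMeasurable X₀ (loebMeasure μ))
    (hν : ∀ n, (ν n : Measure E) = (μ n : Measure (Ω n)).map (X n))
    (hν₀ : (ν₀ : Measure E) = (loebMeasure μ).map X₀) :
    Tendsto ν 𝒰 (𝓝 ν₀) := by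
  refine tendsto_of_forall_isOpen fun G hG ε hε => ?_
  have hlim := tendsto_loebMeasure μ fun n => (hX n) hG.measurableSet
  -- If the limit lies in the open set G, almost all terms do. Only this inclusion holds, but it is
  -- all that the portmanteau criterion asks for.
  have hle : (ν₀ : Measure E) G ≤ loebMeasure μ (internal fun n => X n ⁻¹' G) := by
    rw [hν₀, Measure.map_apply_of_aemeasurable hX₀ hG.measurableSet]
    refine measure_mono_ae ?_
    filter_upwards [h] with x hx hxG
    exact hx.eventually (hG.mem_nhds hxG)
  have hlim' : Tendsto (fun n => (ν n : Measure E).real G) 𝒰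
      (𝓝 ((loebMeasure μ).real (internal fun n => X n ⁻¹' G))) := by
    refine ((ENNReal.tendsto_toReal (measure_ne_top _ _)).comp hlim).congr fun n => ?_
    rw [Measure.real, hν n, Measure.map_apply (hX n) hG.measurableSet]
    rfl
  have hle' : (ν₀ : Measure E).real G ≤ (loebMeasure μ).real (internal fun n => X n ⁻¹' G) :=
    ENNReal.toReal_mono (measure_ne_top _ _) hle
  filter_upwards [hlim'.eventually_const_lt
    (show (ν₀ : Measure E).real G - ε < _ by linarith)] with n hn using hn.le

theorem IsUltralim.tendsto_eLpNorm {X : ∀ n, Ω n → ℝ} {X₀ : LoebSpace Ω → ℝ}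
    (h : IsUltralim μ X X₀) (hX : ∀ n, Measurable (X n)) (hX₀ : AEMeasurable X₀ (loebMeasure μ))
    {M : ℝ} (hM : ∀ n, ∀ᵐ ω ∂(μ n : Measure (Ω n)), |X n ω| ≤ M) {p : ℝ≥0∞} (hp0 : p ≠ 0)
    (hp : p ≠ ∞) :
    Tendsto (fun n => eLpNorm (X n) p (μ n : Measure (Ω n))) 𝒰
      (𝓝 (eLpNorm X₀ p (loebMeasure μ))) := by
  have hclosed : IsClosed {y : ℝ | |y| ≤ M} := isClosed_le continuous_abs continuous_const
  let ν : ℕ → ProbabilityMeasure ℝ := fun n => (μ n).map (hX n).aemeasurable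
  let ν₀ : ProbabilityMeasure ℝ :=
    ⟨(loebMeasure μ).map X₀, Measure.isProbabilityMeasure_map hX₀⟩
  have hν : Tendsto ν 𝒰 (𝓝 ν₀) := h.tendsto_map hX hX₀ (fun n => rfl) rfl
  have hlim := tendsto_eLpNorm_of_tendsto hν continuous_id hp0 hp
    (fun n => (ae_map_iff (hX n).aemeasurable hclosed.measurableSet).2 (hM n))
    ((ae_map_iff hX₀ hclosed.measurableSet).2 (h.ae_mem hclosed hM))
  have h₀ : eLpNorm id p (ν₀ : Measure ℝ) = eLpNorm X₀ p (loebMeasure μ) :=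
    eLpNorm_map_measure aestronglyMeasurable_id hX₀
  rw [h₀] at hlim
  refine hlim.congr fun n => ?_
  exact eLpNorm_map_measure aestronglyMeasurable_id (hX n).aemeasurable

theorem IsUltralim.eLpNorm_le {X : ∀ n, Ω n → ℝ} {X₀ : LoebSpace Ω → ℝ}
    (h : IsUltralim μ X X₀) (hX : ∀ n, Measurable (X n)) (hX₀ : AEMeasurable X₀ (loebMeasure μ))
    {q : ℝ≥0∞} {C : ℕ → ℝ≥0∞} {C₀ : ℝ≥0∞}
    (hC : ∀ n, eLpNorm (X n) q (μ n : Measure (Ω n)) ≤ C n) (hC₀ : Tendsto C 𝒰 (𝓝 C₀)) :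
    eLpNorm X₀ q (loebMeasure μ) ≤ C₀ := by
  let ν : ℕ → ProbabilityMeasure ℝ := fun n => (μ n).map (hX n).aemeasurable
  let ν₀ : ProbabilityMeasure ℝ :=
    ⟨(loebMeasure μ).map X₀, Measure.isProbabilityMeasure_map hX₀⟩
  have hν : Tendsto ν 𝒰 (𝓝 ν₀) := h.tendsto_map hX hX₀ (fun n => rfl) rfl
  have h₀ : eLpNorm id q (ν₀ : Measure ℝ) = eLpNorm X₀ q (loebMeasure μ) :=
    eLpNorm_map_measure aestronglyMeasurable_id hX₀
  rw [← h₀]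
  refine eLpNorm_le_of_tendsto hν continuous_id (fun n => ?_) hC₀
  exact (eLpNorm_map_measure aestronglyMeasurable_id (hX n).aemeasurable).trans_le (hC n)

/-- A sequence of functions bounded in `L^1` has an ultralimit. -/
theorem exists_isUltralim {X : ∀ n, Ω n → ℝ} (hX : ∀ n, Measurable (X n)) {C : ℝ≥0∞} (hC : C ≠ ∞)
    (hXC : ∀ n, eLpNorm (X n) 1 (μ n : Measure (Ω n)) ≤ C) :
    ∃ X₀ : LoebSpace Ω → ℝ, Measurable X₀ ∧ IsUltralim μ X X₀ := by
  -- In the compact space `EReal` the limit always exists; the L¹ bound serves only to make it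
  -- finite almost everywhere.
  let Y : LoebSpace Ω → EReal := fun x =>
    (Ultrafilter.map (fun n => (X n (x n) : EReal)) (hyperfilter ℕ)).lim
  have hY : ∀ x, Tendsto (fun n => (X n (x n) : EReal)) 𝒰 (𝓝 (Y x)) := fun x =>
    (Ultrafilter.map (fun n => (X n (x n) : EReal)) (hyperfilter ℕ)).le_nhds_lim
  have hYm : Measurable Y := by
    refine measurable_of_Ioi fun a => ?_
    -- A rational strictly between `a` and the limit compensates for the loss of strictness in
    -- limits.
    have : Y ⁻¹' Ioi a = ⋃ q ∈ {q : ℚ | a < ((q : ℝ) : EReal)},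
        internal fun n => {ω | (q : ℝ) < X n ω} := by
      ext x
      simp only [mem_preimage, mem_Ioi, mem_iUnion, mem_ofPred_eq, exists_prop]
      constructor
      · intro hx
        obtain ⟨q, h1, h2⟩ := EReal.lt_iff_exists_rat_btwn.1 hx
        refine ⟨q, h1, ?_⟩
        filter_upwards [(hY x).eventually_const_lt h2] with n hn
        exact EReal.coe_lt_coe_iff.1 hn
      · rintro ⟨q, h1, h2⟩
        refine h1.trans_le (ge_of_tendsto (hY x) ?_)
        filter_upwards [h2] with n hn
        exact EReal.coe_le_coe_iff.2 (le_of_lt hn)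
    rw [this]
    exact MeasurableSet.biUnion (to_countable _) fun q _ =>
      measurableSet_internal fun n => measurableSet_lt measurable_const (hX n)
  refine ⟨fun x => (Y x).toReal, hYm.ereal_toReal, ?_⟩
  have hfin : ∀ᵐ x ∂(loebMeasure μ), ∃ N : ℕ, ∀ᶠ n in 𝒰, |X n (x n)| ≤ N := by
    -- Markov's inequality, with N + 1 to avoid dividing by zero.
    have hN : ∀ N : ℕ,
        loebMeasure μ {x | ¬ ∃ N : ℕ, ∀ᶠ n in 𝒰, |X n (x n)| ≤ N} ≤ C / (N + 1 : ℕ) := by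
      intro N
      have hmeas : ∀ n, MeasurableSet {ω | ((N + 1 : ℕ) : ℝ) ≤ |X n ω|} := fun n =>
        measurableSet_le measurable_const (hX n).abs
      have hsub : {x : LoebSpace Ω | ¬ ∃ N : ℕ, ∀ᶠ n in 𝒰, |X n (x n)| ≤ N}
          ⊆ internal fun n => {ω | ((N + 1 : ℕ) : ℝ) ≤ |X n ω|} := by
        intro x hx
        have h1 := not_exists.1 hx (N + 1)
        rw [← Ultrafilter.eventually_not] at h1
        filter_upwards [h1] with n hn using (not_le.1 hn).le
      refine (measure_mono hsub).trans (le_of_tendsto' (tendsto_loebMeasure μ hmeas) fun n => ?_)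
      have := mul_meas_ge_le_lintegral₀ (μ := (μ n : Measure (Ω n)))
        ((hX n).enorm.aemeasurable) ((N + 1 : ℕ) : ℝ≥0∞)
      rw [ENNReal.le_div_iff_mul_le (Or.inl (Nat.cast_ne_zero.2 N.succ_ne_zero))
        (Or.inl (ENNReal.natCast_ne_top _)), mul_comm]
      have h1 := hXC n
      rw [eLpNorm_one_eq_lintegral_enorm] at h1
      refine le_trans (mul_le_mul_right (measure_mono fun ω hω => ?_) _) (this.trans h1)
      have h2 : ((N + 1 : ℕ) : ℝ) ≤ |X n ω| := hω
      rw [mem_ofPred_eq, Real.enorm_eq_ofReal_abs]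
      exact (ENNReal.natCast_le_ofReal N.succ_ne_zero).2 h2
    have h0 : Tendsto (fun N : ℕ => C / (N + 1 : ℕ)) atTop (𝓝 0) := by
      have h1 : Tendsto (fun N : ℕ => C / N) atTop (𝓝 (C / ∞)) :=
        ENNReal.Tendsto.const_div ENNReal.tendsto_nat_nhds_top (Or.inr hC)
      rw [ENNReal.div_top] at h1
      exact (tendsto_add_atTop_iff_nat 1).2 h1
    exact nonpos_iff_eq_zero.1 (ge_of_tendsto' h0 hN)
  filter_upwards [hfin] with x ⟨N, hN⟩
  have h1 : Y x ≤ ((N : ℝ) : EReal) := le_of_tendsto (hY x)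
    (hN.mono fun n hn => EReal.coe_le_coe_iff.2 (abs_le.1 hn).2)
  have h2 : ((-N : ℝ) : EReal) ≤ Y x := ge_of_tendsto (hY x)
    (hN.mono fun n hn => EReal.coe_le_coe_iff.2 (abs_le.1 hn).1)
  exact (EReal.tendsto_toReal (ne_top_of_le_ne_top (EReal.coe_ne_top _) h1)
    (ne_bot_of_le_ne_bot (EReal.coe_ne_bot _) h2)).comp (hY x)

end

/-! ### Lifting bounded functions from the Loeb space -/

section

variable {Ω : ℕ → Type u} [∀ n, MeasurableSpace (Ω n)] {μ : ∀ n, ProbabilityMeasure (Ω n)}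

theorem exists_internal_symmDiff_lt (μ : ∀ n, ProbabilityMeasure (Ω n)) {s : Set (LoebSpace Ω)}
    (hs : MeasurableSet s) {ε : ℝ≥0∞} (hε : 0 < ε) :
    ∃ S : ∀ n, Set (Ω n), (∀ n, MeasurableSet (S n)) ∧ loebMeasure μ (internal S ∆ s) < ε := by
  have hring := isSetAlgebra_internalAlgebra (Ω := Ω)
  obtain ⟨_, ⟨S, hS, rfl⟩, h⟩ := exists_measure_symmDiff_lt_of_generateFrom_isSetRing
    (μ := loebMeasure μ) hring.isSetRing
    ⟨{univ}, countable_singleton _, singleton_subset_iff.2 hring.univ_mem, by simp⟩ rfl hs hε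
  exact ⟨S, hS, h⟩

theorem isUltralim_indicator (S : ∀ n, Set (Ω n)) (c : ℝ) :
    IsUltralim μ (fun n => (S n).indicator fun _ => c) ((internal S).indicator fun _ => c) := by
  refine Eventually.of_forall fun x => ?_
  by_cases hx : x ∈ internal S
  · rw [indicator_of_mem hx]
    refine tendsto_const_nhds.congr' ?_
    filter_upwards [hx] with n hn
    rw [indicator_of_mem hn]
  · rw [indicator_of_notMem hx]
    refine tendsto_const_nhds.congr' ?_
    have hx' : x ∈ (internal S)ᶜ := hx
    rw [internal_compl] at hx'
    filter_upwards [hx'] with n hn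
    rw [indicator_of_notMem hn]

/-- Ultralimits of uniformly bounded sequences are dense in `L^1` of the Loeb measure. -/
theorem exists_isUltralim_eLpNorm_sub_le {h : LoebSpace Ω → ℝ} (hh : MemLp h 1 (loebMeasure μ))
    {ε : ℝ≥0∞} (hε : ε ≠ 0) :
    ∃ g : LoebSpace Ω → ℝ, eLpNorm (h - g) 1 (loebMeasure μ) ≤ ε ∧
      AEStronglyMeasurable g (loebMeasure μ) ∧
      ∃ w : ∀ n, Ω n → ℝ, (∀ n, Measurable (w n)) ∧ IsUltralim μ w g := by
  refine hh.induction_dense ENNReal.one_ne_top (fun g => AEStronglyMeasurable g (loebMeasure μ) ∧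
      ∃ w : ∀ n, Ω n → ℝ, (∀ n, Measurable (w n)) ∧ IsUltralim μ w g) ?_ ?_ (fun f hf => hf.1) hε
  · intro c s hs _ ε hε
    have hδ : 0 < ε / ‖c‖ₑ := ENNReal.div_pos hε enorm_ne_top
    obtain ⟨S, hS, hlt⟩ := exists_internal_symmDiff_lt μ hs hδ
    refine ⟨(internal S).indicator fun _ => c, ?_,
      (measurable_const.indicator (measurableSet_internal hS)).aestronglyMeasurable, _,
      fun n => measurable_const.indicator (hS n), isUltralim_indicator S c⟩
    rw [eLpNorm_indicator_sub_indicator,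
      eLpNorm_indicator_const ((measurableSet_internal hS).symmDiff hs) one_ne_zero
        ENNReal.one_ne_top]
    simp only [ENNReal.toReal_one, div_one, ENNReal.rpow_one]
    exact (mul_le_mul_right hlt.le _).trans ENNReal.mul_div_le
  · rintro f g ⟨hf, w, hw, hwf⟩ ⟨hg, w', hw', hwg⟩
    exact ⟨hf.add hg, _, fun n => (hw n).add (hw' n), hwf.add hwg⟩

/-- Truncation of a real number to `[-M, M]`. -/
def clamp (M y : ℝ) : ℝ := max (-M) (min M y)

theorem continuous_clamp (M : ℝ) : Continuous (clamp M) := by unfold clamp; fun_prop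

theorem abs_clamp_le {M : ℝ} (hM : 0 ≤ M) (y : ℝ) : |clamp M y| ≤ M :=
  abs_le.2 ⟨le_max_left _ _, max_le (by linarith) (min_le_left _ _)⟩

theorem clamp_of_abs_le {M y : ℝ} (hy : |y| ≤ M) : clamp M y = y := by
  rw [clamp, min_eq_right (abs_le.1 hy).2, max_eq_right (abs_le.1 hy).1]

theorem abs_clamp_sub_clamp_le (M x y : ℝ) : |clamp M x - clamp M y| ≤ |x - y| := by
  refine (abs_max_sub_max_le_max _ _ _ _).trans ?_
  rw [sub_self, abs_zero, max_eq_right (abs_nonneg _)]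
  refine (abs_min_sub_min_le_max _ _ _ _).trans ?_
  rw [sub_self, abs_zero, max_eq_right (abs_nonneg _)]

/-- Every bounded measurable function on the Loeb space is an ultralimit, with the same bound. -/
theorem exists_lift {h : LoebSpace Ω → ℝ} (hh : AEStronglyMeasurable h (loebMeasure μ)) {M : ℝ}
    (hM : 0 ≤ M) (hb : ∀ᵐ x ∂(loebMeasure μ), |h x| ≤ M) :
    ∃ w : ∀ n, Ω n → ℝ, (∀ n, Measurable (w n)) ∧ (∀ n ω, |w n ω| ≤ M) ∧ IsUltralim μ w h := by
  have hmem : MemLp h 1 (loebMeasure μ) := MemLp.of_bound hh M hb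
  let e : ℕ → ℝ≥0∞ := fun k => (2⁻¹ : ℝ≥0∞) ^ k
  have he0 : ∀ k, e k ≠ 0 := fun k => pow_ne_zero _ (by simp)
  have hetop : ∀ k, e k ≠ ∞ := fun k => ENNReal.pow_ne_top (by simp)
  have heanti : ∀ j k, j ≤ k → e k ≤ e j := fun j k hjk =>
    pow_le_pow_right_of_le_one' (by simp) hjk
  have hetend : Tendsto e atTop (𝓝 0) :=
    ENNReal.tendsto_pow_atTop_nhds_zero_of_lt_one (by simp)
  choose g' hg' hgm' w' hw' hlim' using fun k => exists_isUltralim_eLpNorm_sub_le hmem (he0 k)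
  -- Clamping is 1-Lipschitz and fixes the values of `h`, so it gives the uniform bound M without
  -- spoiling the L¹ approximation.
  let g : ℕ → LoebSpace Ω → ℝ := fun k x => clamp M (g' k x)
  let w : ℕ → ∀ n, Ω n → ℝ := fun k n ω => clamp M (w' k n ω)
  have hw : ∀ k n, Measurable (w k n) := fun k n => (continuous_clamp M).measurable.comp (hw' k n)
  have hwM : ∀ k n ω, |w k n ω| ≤ M := fun k n ω => abs_clamp_le hM _
  have hlim : ∀ k, IsUltralim μ (w k) (g k) := fun k => (hlim' k).comp (continuous_clamp M)
  have hgm : ∀ k, AEStronglyMeasurable (g k) (loebMeasure μ) := fun k =>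
    (continuous_clamp M).comp_aestronglyMeasurable (hgm' k)
  have hg : ∀ k, eLpNorm (h - g k) 1 (loebMeasure μ) ≤ e k := by
    intro k
    refine (eLpNorm_mono_ae ?_).trans (hg' k)
    filter_upwards [hb] with x hx
    have := abs_clamp_sub_clamp_le M (h x) (g' k x)
    rw [clamp_of_abs_le hx] at this
    exact this
  -- The limits satisfy ‖g j - g k‖₁ ≤ e k + e j ≤ 2 e j. The constant 3 leaves room for a strict
  -- inequality, which holds already for almost all n.
  have hQ : ∀ k, ∀ᶠ n in 𝒰, ∀ j ∈ Finset.range (k + 1),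
      eLpNorm (w j n - w k n) 1 (μ n : Measure (Ω n)) ≤ 3 * e j := by
    intro k
    refine (eventually_all_finset _).2 fun j hj => ?_
    have hjk : j ≤ k := Nat.lt_succ_iff.1 (Finset.mem_range.1 hj)
    have hconv := ((hlim j).sub (hlim k)).tendsto_eLpNorm (M := M + M) (p := 1)
      (fun n => (hw j n).sub (hw k n)) ((hgm j).sub (hgm k)).aemeasurable
      (fun n => Eventually.of_forall fun ω =>
        (abs_sub _ _).trans (add_le_add (hwM j n ω) (hwM k n ω))) one_ne_zero ENNReal.one_ne_top
    have hle : eLpNorm (g j - g k) 1 (loebMeasure μ) < 3 * e j := by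
      have h1 : g j - g k = (h - g k) - (h - g j) := by abel
      rw [h1]
      refine (eLpNorm_sub_le (hh.sub (hgm k)) (hh.sub (hgm j)) le_rfl).trans_lt ?_
      refine (add_le_add ((hg k).trans (heanti j k hjk)) (hg j)).trans_lt ?_
      rw [← two_mul]
      exact ENNReal.mul_lt_mul_left (he0 j) (hetop j) (by norm_num)
    exact (hconv.eventually_lt_const hle).mono fun n hn => hn.le
  obtain ⟨κ, hκ⟩ := exists_diagonal hyperfilter_le_atTop hQ
  let W : ∀ n, Ω n → ℝ := fun n => w (κ n) n
  have hW : ∀ n, Measurable (W n) := fun n => hw _ n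
  have hWM : ∀ n ω, |W n ω| ≤ M := fun n ω => hwM _ n ω
  obtain ⟨W₀, hW₀m, hW₀⟩ := exists_isUltralim (μ := μ) hW (C := ENNReal.ofReal M)
    ENNReal.ofReal_ne_top fun n => by
      refine (eLpNorm_le_of_ae_bound (C := M) (Eventually.of_forall (hWM n))).trans ?_
      simp
  refine ⟨W, hW, hWM, hW₀.congr_right ?_⟩
  -- The diagonal sequence stays within 3 e j of `w j` for almost all n, so its ultralimit is within
  -- 3 e j of `g j`, for every j.
  have hbound : ∀ j, eLpNorm (h - W₀) 1 (loebMeasure μ) ≤ e j + 3 * e j := by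
    intro j
    have hconv := ((hlim j).sub hW₀).tendsto_eLpNorm (M := M + M) (p := 1)
      (fun n => (hw j n).sub (hW n)) ((hgm j).aemeasurable.sub hW₀m.aemeasurable)
      (fun n => Eventually.of_forall fun ω =>
        (abs_sub _ _).trans (add_le_add (hwM j n ω) (hWM n ω))) one_ne_zero ENNReal.one_ne_top
    have h1 : eLpNorm (g j - W₀) 1 (loebMeasure μ) ≤ 3 * e j := by
      refine le_of_tendsto hconv ?_
      filter_upwards [hκ j] with n hn
      exact hn.2 j (Finset.mem_range.2 (Nat.lt_succ_of_le hn.1))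
    have h2 : h - W₀ = (h - g j) + (g j - W₀) := by abel
    rw [h2]
    exact (eLpNorm_add_le (hh.sub (hgm j)) ((hgm j).sub hW₀m.aestronglyMeasurable) le_rfl).trans
      (add_le_add (hg j) h1)
  have hzero : eLpNorm (h - W₀) 1 (loebMeasure μ) = 0 := by
    have h1 : Tendsto (fun j => e j + 3 * e j) atTop (𝓝 0) := by
      have := hetend.add (ENNReal.Tendsto.const_mul hetend (a := 3) (Or.inr (by simp)))
      simpa using this
    exact nonpos_iff_eq_zero.1 (ge_of_tendsto' h1 hbound)
  have := (eLpNorm_eq_zero_iff (hh.sub hW₀m.aestronglyMeasurable) one_ne_zero).1 hzero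
  filter_upwards [this] with x hx
  exact (sub_eq_zero.1 hx).symm

end

/-! ### Ultralimits of operators -/

section

theorem eLpNorm_le_opNorm_mul {Ω : Type u} [MeasurableSpace Ω] {μ : Measure Ω} [IsFiniteMeasure μ]
    {p q : ℝ≥0∞} (hp0 : p ≠ 0) {T : Lp ℝ ∞ μ →ₗ[ℝ] Lp ℝ 1 μ} {C : ℝ≥0∞}
    (hC : opNorm p q T ≤ C) (v : Lp ℝ ∞ μ) : eLpNorm (T v) q μ ≤ C * eLpNorm v p μ := by
  rcases eq_or_ne (eLpNorm v p μ) 0 with h0 | h0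
  · have hv : v = 0 :=
      (Lp.eq_zero_iff_ae_eq_zero).2 ((eLpNorm_eq_zero_iff (Lp.aestronglyMeasurable v) hp0).1 h0)
    subst hv
    rw [map_zero, eLpNorm_congr_ae (Lp.coeFn_zero ℝ 1 μ), eLpNorm_zero]
    exact zero_le
  · have htop : eLpNorm v p μ ≠ ∞ := ((Lp.memLp v).mono_exponent le_top).eLpNorm_ne_top
    exact (ENNReal.div_le_iff_le_mul (Or.inl h0) (Or.inl htop)).1
      ((le_iSup (fun v : Lp ℝ ∞ μ => eLpNorm (T v) q μ / eLpNorm v p μ) v).trans hC)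

theorem opNorm_le_of_eLpNorm_le {Ω : Type u} [MeasurableSpace Ω] {μ : Measure Ω}
    {p q : ℝ≥0∞} {T : Lp ℝ ∞ μ →ₗ[ℝ] Lp ℝ 1 μ} {C : ℝ≥0∞}
    (hC : ∀ v, eLpNorm (T v) q μ ≤ C * eLpNorm v p μ) : opNorm p q T ≤ C :=
  iSup_le fun v => ENNReal.div_le_of_le_mul (hC v)

variable (A : ℕ → POperator.{u})

/-- A sequence of elements of `L^∞` that is uniformly bounded. -/
def UniformlyBounded (u : ∀ n, Lp ℝ ∞ ((A n).μ : Measure (A n).Ω)) : Prop :=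
  ∃ M : ℝ, ∀ n, ∀ᵐ ω ∂((A n).μ : Measure (A n).Ω), |u n ω| ≤ M

variable {A}

theorem UniformlyBounded.add {u u' : ∀ n, Lp ℝ ∞ ((A n).μ : Measure (A n).Ω)}
    (h : UniformlyBounded A u) (h' : UniformlyBounded A u') : UniformlyBounded A (u + u') := by
  obtain ⟨M, hM⟩ := h
  obtain ⟨M', hM'⟩ := h'
  refine ⟨M + M', fun n => ?_⟩
  filter_upwards [hM n, hM' n, Lp.coeFn_add (u n) (u' n)] with ω h1 h2 h3
  rw [Pi.add_apply, h3]
  exact (abs_add_le _ _).trans (add_le_add h1 h2)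

theorem UniformlyBounded.const_smul {u : ∀ n, Lp ℝ ∞ ((A n).μ : Measure (A n).Ω)}
    (h : UniformlyBounded A u) (c : ℝ) : UniformlyBounded A (c • u) := by
  obtain ⟨M, hM⟩ := h
  refine ⟨|c| * M, fun n => ?_⟩
  filter_upwards [hM n, Lp.coeFn_smul c (u n)] with ω h1 h3
  rw [Pi.smul_apply, h3, Pi.smul_apply, smul_eq_mul, abs_mul]
  exact mul_le_mul_of_nonneg_left h1 (abs_nonneg c)

theorem IsUltralim.lp_add {p : ℝ≥0∞} {u u' : ∀ n, Lp ℝ p ((A n).μ : Measure (A n).Ω)}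
    {v v' : Lp ℝ p (loebMeasure fun n => (A n).μ)}
    (h : IsUltralim (fun n => (A n).μ) (fun n => u n) v)
    (h' : IsUltralim (fun n => (A n).μ) (fun n => u' n) v') :
    IsUltralim (fun n => (A n).μ) (fun n => ⇑(u n + u' n)) (v + v' : Lp ℝ p _) :=
  ((h.add h').congr_left fun _ => (Lp.coeFn_add _ _).symm).congr_right (Lp.coeFn_add _ _).symm

theorem IsUltralim.lp_smul {p : ℝ≥0∞} {u : ∀ n, Lp ℝ p ((A n).μ : Measure (A n).Ω)}
    {v : Lp ℝ p (loebMeasure fun n => (A n).μ)}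
    (h : IsUltralim (fun n => (A n).μ) (fun n => u n) v) (c : ℝ) :
    IsUltralim (fun n => (A n).μ) (fun n => ⇑(c • u n)) (c • v : Lp ℝ p _) :=
  ((h.const_smul c).congr_left fun _ => (Lp.coeFn_smul _ _).symm).congr_right
    (Lp.coeFn_smul _ _).symm

theorem measurable_lp {Ω : Type u} [MeasurableSpace Ω] {μ : Measure Ω} {p : ℝ≥0∞} (f : Lp ℝ p μ) :
    Measurable f := (Lp.stronglyMeasurable f).measurable

variable {p C : ℝ≥0∞}

theorem eLpNorm_op_le (hA : ∀ n, (A n).norm p 1 ≤ C) (hp0 : p ≠ 0) (n : ℕ)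
    (v : Lp ℝ ∞ ((A n).μ : Measure (A n).Ω)) :
    eLpNorm ((A n).op v) 1 ((A n).μ : Measure (A n).Ω) ≤
      C * eLpNorm v p ((A n).μ : Measure (A n).Ω) :=
  eLpNorm_le_opNorm_mul hp0 (hA n) v

/-- The left side is lower semicontinuous, while the right side converges because the `u n` are
uniformly bounded and p < ∞. Applied with limit 0, this makes the limit operator well defined. -/
theorem eLpNorm_op_le_of_isUltralim (hA : ∀ n, (A n).norm p 1 ≤ C) (hC : C ≠ ∞) (hp0 : p ≠ 0)
    (hp : p ≠ ∞) {u : ∀ n, Lp ℝ ∞ ((A n).μ : Measure (A n).Ω)} (hu : UniformlyBounded A u)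
    {v w : LoebSpace (fun n => (A n).Ω) → ℝ}
    (hv : AEMeasurable v (loebMeasure fun n => (A n).μ))
    (hw : AEMeasurable w (loebMeasure fun n => (A n).μ))
    (huv : IsUltralim (fun n => (A n).μ) (fun n => u n) v)
    (huw : IsUltralim (fun n => (A n).μ) (fun n => (A n).op (u n)) w) :
    eLpNorm w 1 (loebMeasure fun n => (A n).μ) ≤ C * eLpNorm v p (loebMeasure fun n => (A n).μ) := by
  obtain ⟨M, hM⟩ := hu
  exact huw.eLpNorm_le (fun n => measurable_lp _) hw (fun n => eLpNorm_op_le hA hp0 n (u n))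
    (ENNReal.Tendsto.const_mul
      (huv.tendsto_eLpNorm (fun n => measurable_lp _) hv hM hp0 hp) (Or.inr hC))

theorem exists_isUltralim_op (hA : ∀ n, (A n).norm p 1 ≤ C) (hC : C ≠ ∞) (hp0 : p ≠ 0)
    {u : ∀ n, Lp ℝ ∞ ((A n).μ : Measure (A n).Ω)} (hu : UniformlyBounded A u) :
    ∃ w : Lp ℝ 1 (loebMeasure fun n => (A n).μ),
      IsUltralim (fun n => (A n).μ) (fun n => (A n).op (u n)) w := by
  obtain ⟨M, hM⟩ := hu
  have hbound : ∀ n, eLpNorm ((A n).op (u n)) 1 ((A n).μ : Measure (A n).Ω) ≤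
      C * ENNReal.ofReal M := by
    intro n
    refine (eLpNorm_op_le hA hp0 n (u n)).trans (mul_le_mul_right ?_ _)
    refine (eLpNorm_le_of_ae_bound (C := M) (hM n)).trans ?_
    simp
  obtain ⟨X₀, hX₀, hlim⟩ := exists_isUltralim (μ := fun n => (A n).μ)
    (fun n => measurable_lp ((A n).op (u n))) (ENNReal.mul_ne_top hC ENNReal.ofReal_ne_top) hbound
  have hmem : MemLp X₀ 1 (loebMeasure fun n => (A n).μ) :=
    ⟨hX₀.aestronglyMeasurable, (hlim.eLpNorm_le (fun n => measurable_lp _) hX₀.aemeasurable hbound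
      tendsto_const_nhds).trans_lt (ENNReal.mul_lt_top hC.lt_top ENNReal.ofReal_lt_top)⟩
  exact ⟨hmem.toLp X₀, hlim.congr_right hmem.coeFn_toLp.symm⟩

theorem exists_lp_lift (v : Lp ℝ ∞ (loebMeasure fun n => (A n).μ)) {M : ℝ} (hM : 0 ≤ M)
    (hv : ∀ᵐ x ∂(loebMeasure fun n => (A n).μ), |v x| ≤ M) :
    ∃ u : ∀ n, Lp ℝ ∞ ((A n).μ : Measure (A n).Ω),
      (∀ n, ∀ᵐ ω ∂((A n).μ : Measure (A n).Ω), |u n ω| ≤ M) ∧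
      IsUltralim (fun n => (A n).μ) (fun n => u n) v := by
  obtain ⟨w, hw, hwM, hlim⟩ := exists_lift (Lp.aestronglyMeasurable v) hM hv
  have hmem : ∀ n, MemLp (w n) ∞ ((A n).μ : Measure (A n).Ω) := fun n =>
    memLp_top_of_bound (hw n).aestronglyMeasurable M (Eventually.of_forall (hwM n))
  refine ⟨fun n => (hmem n).toLp (w n), fun n => ?_,
    hlim.congr_left fun n => (hmem n).coeFn_toLp.symm⟩
  filter_upwards [(hmem n).coeFn_toLp] with ω hω
  rw [hω]
  exact hwM n ω

theorem ae_abs_le_norm {Ω : Type u} [MeasurableSpace Ω] {μ : Measure Ω} (v : Lp ℝ ∞ μ) :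
    ∀ᵐ x ∂μ, |v x| ≤ ‖v‖ := by
  have h := ae_le_eLpNormEssSup (f := v) (μ := μ)
  filter_upwards [h] with x hx
  rw [Lp.norm_def, eLpNorm_exponent_top, ← Real.norm_eq_abs, ← toReal_enorm]
  refine ENNReal.toReal_mono ?_ hx
  rw [← eLpNorm_exponent_top]
  exact Lp.eLpNorm_ne_top v

/-- The ultralimit of a bounded sequence of operators. -/
theorem exists_ultralim_op (hA : ∀ n, (A n).norm p 1 ≤ C) (hC : C ≠ ∞) (hp0 : p ≠ 0)
    (hp : p ≠ ∞) :
    ∃ T : Lp ℝ ∞ (loebMeasure fun n => (A n).μ) →ₗ[ℝ] Lp ℝ 1 (loebMeasure fun n => (A n).μ),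
      ∀ (u : ∀ n, Lp ℝ ∞ ((A n).μ : Measure (A n).Ω)) (v : Lp ℝ ∞ (loebMeasure fun n => (A n).μ)),
        UniformlyBounded A u → IsUltralim (fun n => (A n).μ) (fun n => u n) v →
        IsUltralim (fun n => (A n).μ) (fun n => (A n).op (u n)) (T v) := by
  have hex : ∀ v : Lp ℝ ∞ (loebMeasure fun n => (A n).μ),
      ∃ w : Lp ℝ 1 (loebMeasure fun n => (A n).μ), ∃ u, UniformlyBounded A u ∧
        IsUltralim (fun n => (A n).μ) (fun n => u n) v ∧
        IsUltralim (fun n => (A n).μ) (fun n => (A n).op (u n)) w := by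
    intro v
    obtain ⟨u, hu, huv⟩ := exists_lp_lift v (norm_nonneg v) (ae_abs_le_norm v)
    obtain ⟨w, hw⟩ := exists_isUltralim_op hA hC hp0 ⟨‖v‖, hu⟩
    exact ⟨w, u, ⟨‖v‖, hu⟩, huv, hw⟩
  choose T U hU hUv hUT using hex
  -- The difference of two lifts of `v` is a uniformly bounded lift of 0, so its images have
  -- ultralimit 0.
  have key : ∀ (u : ∀ n, Lp ℝ ∞ ((A n).μ : Measure (A n).Ω)) (v : Lp ℝ ∞ (loebMeasure fun n => (A n).μ)),
        UniformlyBounded A u → IsUltralim (fun n => (A n).μ) (fun n => u n) v →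
        IsUltralim (fun n => (A n).μ) (fun n => (A n).op (u n)) (T v) := by
    intro u v hu huv
    obtain ⟨w, hw⟩ := exists_isUltralim_op hA hC hp0 hu
    have hd : UniformlyBounded A (u + (-1 : ℝ) • U v) := hu.add ((hU v).const_smul (-1))
    have h1 := huv.lp_add ((hUv v).lp_smul (-1))
    have h2 := hw.lp_add ((hUT v).lp_smul (-1))
    have h3 : ∀ n, (A n).op (u n) + (-1 : ℝ) • (A n).op (U v n)
        = (A n).op ((u + (-1 : ℝ) • U v) n) := fun n => by
      rw [Pi.add_apply, Pi.smul_apply, map_add, map_smul]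
    simp only [h3] at h2
    have h4 := eLpNorm_op_le_of_isUltralim hA hC hp0 hp hd (measurable_lp _).aemeasurable
      (measurable_lp _).aemeasurable h1 h2
    have h5 : v + (-1 : ℝ) • v = 0 := by simp
    rw [h5, eLpNorm_congr_ae (Lp.coeFn_zero ℝ ∞ _), eLpNorm_zero, mul_zero,
      nonpos_iff_eq_zero, eLpNorm_eq_zero_iff (Lp.aestronglyMeasurable _) one_ne_zero] at h4
    have h6 : w + (-1 : ℝ) • T v = 0 := Lp.eq_zero_iff_ae_eq_zero.2 h4
    have h7 : w = T v := by
      rw [neg_one_smul] at h6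
      exact add_neg_eq_zero.1 h6
    rwa [← h7]
  -- Sums and multiples of lifts are lifts, so linearity follows from independence of the lift.
  refine ⟨⟨⟨T, fun v v' => ?_⟩, fun c v => ?_⟩, key⟩
  · have h1 := key _ _ ((hU v).add (hU v')) ((hUv v).lp_add (hUv v'))
    have h2 := (hUT v).lp_add (hUT v')
    simp only [Pi.add_apply, map_add] at h1
    exact Lp.ext (h1.ae_eq h2)
  · have h1 := key _ _ ((hU v).const_smul c) ((hUv v).lp_smul c)
    have h2 := (hUT v).lp_smul c
    simp only [Pi.smul_apply, map_smul] at h1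
    exact Lp.ext (h1.ae_eq h2)

end

/-! ### Atomlessness of Loeb spaces -/

/-- In an atomless finite measure space every measurable set has a measurable subset whose measure
lies between one third and two thirds of it. -/
theorem IsAtomless.exists_third {Ω : Type u} [MeasurableSpace Ω] {μ : Measure Ω}
    [IsFiniteMeasure μ] (h : IsAtomless μ) {s : Set Ω} (hs : MeasurableSet s) :
    ∃ t, t ⊆ s ∧ MeasurableSet t ∧ μ.real s ≤ 3 * μ.real t ∧ 3 * μ.real t ≤ 2 * μ.real s := by
  by_contra! hcon
  have hs0 : 0 < μ.real s := by
    by_contra h0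
    have h1 := hcon ∅ (empty_subset s) MeasurableSet.empty
    simp only [measureReal_empty, mul_zero] at h1
    linarith [h1 (not_lt.1 h0), measureReal_nonneg (μ := μ) (s := s)]
  -- If no subset has between one and two thirds of the mass, every subset of at most two thirds
  -- lies in 𝒢, so 𝒢 is closed under unions. For T ∈ 𝒢 of maximal mass, each non-null subset of `s \
  -- T` exceeds two thirds; atomlessness splits `s \ T` into two of these, which is too much.
  let 𝒢 : Set (Set Ω) := {t | t ⊆ s ∧ MeasurableSet t ∧ 3 * μ.real t < μ.real s}
  have hsmall : ∀ t, t ⊆ s → MeasurableSet t → 3 * μ.real t ≤ 2 * μ.real s → t ∈ 𝒢 :=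
    fun t ht hm hle => ⟨ht, hm, by
      by_contra h3
      exact absurd hle (not_le.2 (hcon t ht hm (not_lt.1 h3)))⟩
  have hunion : ∀ t ∈ 𝒢, ∀ t' ∈ 𝒢, t ∪ t' ∈ 𝒢 := by
    rintro t ⟨h1, h2, h3⟩ t' ⟨h1', h2', h3'⟩
    refine hsmall _ (union_subset h1 h1') (h2.union h2') ?_
    linarith [measureReal_union_le (μ := μ) t t']
  have hempty : ∅ ∈ 𝒢 := ⟨empty_subset s, MeasurableSet.empty, by simpa using hs0⟩
  have hbdd : BddAbove (μ.real '' 𝒢) :=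
    ⟨μ.real s, by rintro _ ⟨t, ht, rfl⟩; exact measureReal_mono ht.1⟩
  obtain ⟨a, -, ha, ha𝒢⟩ := exists_seq_tendsto_sSup ⟨_, mem_image_of_mem μ.real hempty⟩ hbdd
  choose t ht hta using ha𝒢
  have hacc : ∀ n, accumulate t n ∈ 𝒢 := by
    intro n
    induction n with
    | zero => rw [accumulate_zero_nat]; exact ht 0
    | succ n ih => rw [accumulate_succ]; exact hunion _ ih _ (ht _)
  let T := ⋃ n, accumulate t n
  have hTm : MeasurableSet T := MeasurableSet.iUnion fun n => (hacc n).2.1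
  have hTs : T ⊆ s := iUnion_subset fun n => (hacc n).1
  have hTlim : Tendsto (fun n => μ.real (accumulate t n)) atTop (𝓝 (μ.real T)) :=
    (ENNReal.tendsto_toReal (measure_ne_top μ T)).comp
      (tendsto_measure_iUnion_atTop monotone_accumulate)
  have hT : T ∈ 𝒢 := by
    refine hsmall T hTs hTm ?_
    have : μ.real T ≤ μ.real s / 3 := le_of_tendsto' hTlim fun n => by linarith [(hacc n).2.2]
    linarith
  have hsup : sSup (μ.real '' 𝒢) ≤ μ.real T := by
    refine le_of_tendsto' ha fun n => ?_
    rw [← hta n]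
    exact measureReal_mono ((subset_accumulate (s := t) (x := n)).trans (subset_iUnion _ n))
  have hmax : ∀ r ∈ 𝒢, Disjoint T r → μ.real r = 0 := by
    intro r hr hd
    have h1 := le_csSup hbdd (mem_image_of_mem μ.real (hunion T hT r hr))
    rw [measureReal_union hd hr.2.1] at h1
    linarith [measureReal_nonneg (μ := μ) (s := r)]
  have hdiff : μ.real (s \ T) = μ.real s - μ.real T := measureReal_sdiff hTs hTm
  have hpos : 0 < μ (s \ T) := by
    have : 0 < μ.real (s \ T) := by linarith [hT.2.2]
    exact (ENNReal.toReal_pos_iff.1 this).1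
  obtain ⟨r, hr, hrm, hr0, hrlt⟩ := h (s \ T) (hs.diff hTm) hpos
  have hr0' : 0 < μ.real r := ENNReal.toReal_pos hr0.ne' (measure_ne_top _ _)
  have hrlt' : μ.real r < μ.real (s \ T) :=
    (ENNReal.toReal_lt_toReal (measure_ne_top _ _) (measure_ne_top _ _)).2 hrlt
  have hdr : μ.real ((s \ T) \ r) = μ.real (s \ T) - μ.real r := measureReal_sdiff hr hrm
  have hbig : ∀ r', r' ⊆ s \ T → MeasurableSet r' → 0 < μ.real r' →
      2 * μ.real s < 3 * μ.real r' := by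
    intro r' hr' hm' h0'
    by_contra hle
    exact h0'.ne' (hmax r' (hsmall r' (hr'.trans sdiff_subset) hm' (not_lt.1 hle))
      (disjoint_sdiff_self_right.mono_right hr'))
  have h1 := hbig r hr hrm hr0'
  have h2 := hbig ((s \ T) \ r) sdiff_subset ((hs.diff hTm).diff hrm) (by linarith)
  linarith [measureReal_nonneg (μ := μ) (s := T)]

/-- A Loeb space of atomless probability spaces is atomless. -/
theorem isAtomless_loebMeasure {Ω : ℕ → Type u} [∀ n, MeasurableSpace (Ω n)]
    {μ : ∀ n, ProbabilityMeasure (Ω n)} (h : ∀ n, IsAtomless (μ n : Measure (Ω n))) :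
    IsAtomless (loebMeasure μ) := by
  intro s hs hs0
  have hs0' : 0 < (loebMeasure μ).real s := ENNReal.toReal_pos hs0.ne' (measure_ne_top _ _)
  -- With m the mass of s and error below m/5, `internal T` has mass above 4m/15 > m/5, so it meets
  -- s in positive mass, and below (2/3)(6m/5) < m.
  obtain ⟨S, hS, hlt⟩ := exists_internal_symmDiff_lt μ hs
    (ε := ENNReal.ofReal ((loebMeasure μ).real s / 5)) (by simpa using hs0')
  have hSm := measurableSet_internal hS
  have hlt' : (loebMeasure μ).real (internal S ∆ s) < (loebMeasure μ).real s / 5 :=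
    (ENNReal.lt_ofReal_iff_toReal_lt (measure_ne_top _ _)).1 hlt
  -- Thirds are used because the strict inequalities 0 < μ T < μ S alone could degenerate in the
  -- limit.
  choose T hTS hT h1 h2 using fun n => (h n).exists_third (hS n)
  have hTm := measurableSet_internal hT
  have hlim : ∀ {R : ∀ n, Set (Ω n)}, (∀ n, MeasurableSet (R n)) →
      Tendsto (fun n => (μ n : Measure (Ω n)).real (R n)) 𝒰
        (𝓝 ((loebMeasure μ).real (internal R))) := fun hR =>
    (ENNReal.tendsto_toReal (measure_ne_top _ _)).comp (tendsto_loebMeasure μ hR)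
  have h1' : (loebMeasure μ).real (internal S) ≤ 3 * (loebMeasure μ).real (internal T) :=
    le_of_tendsto_of_tendsto' (hlim hS) ((hlim hT).const_mul 3) h1
  have h2' : 3 * (loebMeasure μ).real (internal T) ≤ 2 * (loebMeasure μ).real (internal S) :=
    le_of_tendsto_of_tendsto' ((hlim hT).const_mul 3) ((hlim hS).const_mul 2) h2
  have hsub : internal T ⊆ internal S := internal_mono_of_eventually (Eventually.of_forall hTS)
  have e1 : (loebMeasure μ).real s ≤
      (loebMeasure μ).real (internal S) + (loebMeasure μ).real (internal S ∆ s) := by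
    refine (measureReal_mono ?_).trans (measureReal_union_le _ _)
    intro x hx
    by_cases hxS : x ∈ internal S
    · exact Or.inl hxS
    · exact Or.inr (Or.inr ⟨hx, hxS⟩)
  have e2 : (loebMeasure μ).real (internal T) ≤
      (loebMeasure μ).real (s ∩ internal T) + (loebMeasure μ).real (internal S ∆ s) := by
    refine (measureReal_mono ?_).trans (measureReal_union_le _ _)
    intro x hx
    by_cases hxs : x ∈ s
    · exact Or.inl ⟨hxs, hx⟩
    · exact Or.inr (Or.inl ⟨hsub hx, hxs⟩)
  have e3 : (loebMeasure μ).real (internal S) ≤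
      (loebMeasure μ).real s + (loebMeasure μ).real (internal S ∆ s) := by
    refine (measureReal_mono ?_).trans (measureReal_union_le _ _)
    intro x hx
    by_cases hxs : x ∈ s
    · exact Or.inl hxs
    · exact Or.inr (Or.inl ⟨hx, hxs⟩)
  have e4 : (loebMeasure μ).real (s ∩ internal T) ≤ (loebMeasure μ).real (internal T) :=
    measureReal_mono inter_subset_right
  refine ⟨s ∩ internal T, inter_subset_left, hs.inter hTm, ?_, ?_⟩
  · have : 0 < (loebMeasure μ).real (s ∩ internal T) := by linarith
    exact (ENNReal.toReal_pos_iff.1 this).1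
  · refine (ENNReal.toReal_lt_toReal (measure_ne_top _ _) (measure_ne_top _ _)).1 ?_
    change (loebMeasure μ).real (s ∩ internal T) < (loebMeasure μ).real s
    linarith

/-! ### Convergence of profiles and norms -/

namespace POperator

theorem measurable_jointMap (A : POperator.{u}) {k : ℕ}
    (v : Fin k → Lp ℝ ∞ (A.μ : Measure A.Ω)) : Measurable (A.jointMap v) := by
  refine (WithLp.measurable_toLp 2 (Fin k ⊕ Fin k → ℝ)).comp (measurable_pi_lambda _ ?_)
  rintro (i | i)
  · exact measurable_lp (v i)
  · exact measurable_lp (A.op (v i))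

/-- Bounded sequences of `P`-operators have ultralimits, whose profiles are the ultralimits of the
profiles. -/
theorem exists_ultralimit {A : ℕ → POperator.{u}} {p C : ℝ≥0∞}
    (hA : ∀ n, (A n).norm p 1 ≤ C) (hC : C ≠ ∞) (hp0 : p ≠ 0) (hp : p ≠ ∞) :
    ∃ B : POperator.{u}, ((∀ n, (A n).Atomless) → B.Atomless) ∧
      (∀ (k : ℕ) (ν : ℕ → LPSpace k), (∀ n, ν n ∈ (A n).profile k) →
        ∃ ν₀ ∈ B.profile k, Tendsto ν 𝒰 (𝓝 ν₀)) ∧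
      (∀ (k : ℕ), ∀ ν₀ ∈ B.profile k, ∃ ν : ℕ → LPSpace k,
        (∀ n, ν n ∈ (A n).profile k) ∧ Tendsto ν 𝒰 (𝓝 ν₀)) := by
  obtain ⟨T, hT⟩ := exists_ultralim_op hA hC hp0 hp
  have hbounded : opNorm ∞ 1 T < ∞ := by
    refine (opNorm_le_of_eLpNorm_le (C := C) fun v => ?_).trans_lt hC.lt_top
    obtain ⟨u, hu, huv⟩ := exists_lp_lift v (norm_nonneg v) (ae_abs_le_norm v)
    refine (eLpNorm_op_le_of_isUltralim hA hC hp0 hp ⟨_, hu⟩ (measurable_lp _).aemeasurable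
      (measurable_lp _).aemeasurable huv (hT u v ⟨_, hu⟩ huv)).trans (mul_le_mul_right ?_ _)
    exact eLpNorm_le_eLpNorm_of_exponent_le le_top (Lp.aestronglyMeasurable v)
  let B : POperator.{u} :=
    { Ω := LoebSpace fun n => (A n).Ω
      μ := ⟨loebMeasure fun n => (A n).μ, inferInstance⟩
      op := T
      bounded := hbounded }
  have hconv : ∀ (k : ℕ) (u : ∀ n, Fin k → Lp ℝ ∞ ((A n).μ : Measure (A n).Ω))
      (v : Fin k → Lp ℝ ∞ (B.μ : Measure B.Ω)), (∀ i, UniformlyBounded A fun n => u n i) →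
      (∀ i, IsUltralim (fun n => (A n).μ) (fun n => u n i) (v i)) →
      Tendsto (fun n => (A n).jointLaw (u n)) 𝒰 (𝓝 (B.jointLaw v)) := by
    intro k u v hu huv
    have hlim : IsUltralim (fun n => (A n).μ) (fun n => (A n).jointMap (u n)) (B.jointMap v) := by
      have h1 := eventually_countable_forall.2 huv
      have h2 := eventually_countable_forall.2 fun i => hT _ _ (hu i) (huv i)
      filter_upwards [h1, h2] with x hx1 hx2
      refine ((PiLp.continuous_toLp 2 _).tendsto _).comp (tendsto_pi_nhds.2 ?_)
      rintro (i | i)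
      · exact hx1 i
      · exact hx2 i
    have hlaw := hlim.tendsto_map (fun n => (A n).measurable_jointMap (u n))
      (ν := fun n => (A n).μ.map ((A n).aemeasurable_jointMap (u n)))
      (ν₀ := B.μ.map (B.aemeasurable_jointMap v)) (B.aemeasurable_jointMap v)
      (fun n => rfl) rfl
    exact (LevyProkhorov.continuous_ofMeasure_probabilityMeasure.tendsto _).comp hlaw
  have hIcc : ∀ y : ℝ, y ∈ Icc (-1 : ℝ) 1 ↔ |y| ≤ 1 := fun y => by rw [mem_Icc, abs_le]
  refine ⟨B, fun h => isAtomless_loebMeasure h, ?_, ?_⟩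
  · intro k ν hν
    choose u hu huν using hν
    have hu1 : ∀ i n, ∀ᵐ ω ∂((A n).μ : Measure (A n).Ω), |u n i ω| ≤ 1 := fun i n =>
      (hu n i).mono fun ω hω => (hIcc _).1 hω
    have hex : ∀ i, ∃ v : Lp ℝ ∞ (B.μ : Measure B.Ω), (∀ᵐ x ∂(B.μ : Measure B.Ω), |v x| ≤ 1) ∧
        IsUltralim (fun n => (A n).μ) (fun n => u n i) v := by
      intro i
      obtain ⟨X₀, hX₀, hlim⟩ := exists_isUltralim (μ := fun n => (A n).μ) (C := ENNReal.ofReal 1)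
        (fun n => measurable_lp (u n i)) ENNReal.ofReal_ne_top fun n => by
          refine (eLpNorm_le_of_ae_bound (C := 1) (hu1 i n)).trans ?_
          simp
      have hb : ∀ᵐ x ∂(loebMeasure fun n => (A n).μ), |X₀ x| ≤ 1 :=
        hlim.ae_mem (isClosed_le continuous_abs continuous_const) (hu1 i)
      have hmem : MemLp X₀ ∞ (loebMeasure fun n => (A n).μ) :=
        memLp_top_of_bound hX₀.aestronglyMeasurable 1 hb
      refine ⟨hmem.toLp X₀, ?_, hlim.congr_right hmem.coeFn_toLp.symm⟩
      filter_upwards [hb, hmem.coeFn_toLp] with x hx hx'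
      exact (congrArg abs hx').trans_le hx
    choose v hv1 hv using hex
    refine ⟨B.jointLaw v, ⟨v, fun i => (hv1 i).mono fun x hx => (hIcc _).2 hx, rfl⟩, ?_⟩
    exact (hconv k u v (fun i => ⟨1, hu1 i⟩) hv).congr huν
  · rintro k _ ⟨v, hv, rfl⟩
    have hex := fun i => exists_lp_lift (A := A) (v i) zero_le_one
      ((hv i).mono fun x hx => (hIcc _).1 hx)
    choose u hu1 hu using hex
    refine ⟨fun n => (A n).jointLaw fun i => u i n,
      fun n => ⟨_, fun i => (hu1 i n).mono fun ω hω => (hIcc _).2 hω, rfl⟩,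
      hconv k (fun n i => u i n) v (fun i => ⟨1, hu1 i⟩) hu⟩

theorem eLpNorm_inl_jointLaw (A : POperator.{u}) {k : ℕ} (v : Fin k → Lp ℝ ∞ (A.μ : Measure A.Ω))
    (i : Fin k) (p : ℝ≥0∞) :
    eLpNorm (fun x : E k => x (Sum.inl i)) p ((A.jointLaw v).toMeasure : Measure (E k))
      = eLpNorm (v i) p (A.μ : Measure A.Ω) :=
  eLpNorm_map_measure (by fun_prop) (A.aemeasurable_jointMap v)

theorem eLpNorm_inr_jointLaw (A : POperator.{u}) {k : ℕ} (v : Fin k → Lp ℝ ∞ (A.μ : Measure A.Ω))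
    (i : Fin k) (p : ℝ≥0∞) :
    eLpNorm (fun x : E k => x (Sum.inr i)) p ((A.jointLaw v).toMeasure : Measure (E k))
      = eLpNorm (A.op (v i)) p (A.μ : Measure A.Ω) :=
  eLpNorm_map_measure (by fun_prop) (A.aemeasurable_jointMap v)

/-- The norm `‖·‖_{p → q}` is lower semicontinuous with respect to approximation of `1`-profiles. -/
theorem norm_le_of_tendsto_profile {ι : Type*} {l : Filter ι} [l.NeBot] {A : ι → POperator.{u}}
    {B : POperator.{u}} {p q C : ℝ≥0∞} (hA : ∀ i, (A i).norm p q ≤ C) (hC : C ≠ ∞) (hp0 : p ≠ 0)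
    (hp : p ≠ ∞)
    (h : ∀ ν₀ ∈ B.profile 1, ∃ ν : ι → LPSpace 1,
      (∀ i, ν i ∈ (A i).profile 1) ∧ Tendsto ν l (𝓝 ν₀)) :
    B.norm p q ≤ C := by
  have hIcc : ∀ y : ℝ, y ∈ Icc (-1 : ℝ) 1 ↔ |y| ≤ 1 := fun y => by rw [mem_Icc, abs_le]
  -- Both norms are read off the joint law: that of the bounded first coordinate converges, that of
  -- the second is lower semicontinuous. Homogeneity then removes the bound |v| ≤ 1.
  have hunit : ∀ v : Lp ℝ ∞ (B.μ : Measure B.Ω), (∀ᵐ ω ∂(B.μ : Measure B.Ω), |v ω| ≤ 1) →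
      eLpNorm (B.op v) q (B.μ : Measure B.Ω) ≤ C * eLpNorm v p (B.μ : Measure B.Ω) := by
    intro v hv
    obtain ⟨ν, hν, hlim⟩ := h (B.jointLaw fun _ => v)
      ⟨_, fun _ => hv.mono fun ω hω => (hIcc _).2 hω, rfl⟩
    choose u hu huν using hν
    have hlim' : Tendsto (fun i => (ν i).toMeasure) l (𝓝 (B.jointLaw fun _ => v).toMeasure) :=
      (LevyProkhorov.continuous_toMeasure_probabilityMeasure.tendsto _).comp hlim
    have hclosed : MeasurableSet {x : E 1 | |x (Sum.inl 0)| ≤ 1} :=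
      (isClosed_le (by fun_prop) continuous_const).measurableSet
    have hb : ∀ (A : POperator.{u}) (w : Fin 1 → Lp ℝ ∞ (A.μ : Measure A.Ω)),
        (∀ᵐ ω ∂(A.μ : Measure A.Ω), |w 0 ω| ≤ 1) →
        ∀ᵐ x ∂((A.jointLaw w).toMeasure : Measure (E 1)), |x (Sum.inl 0)| ≤ 1 := fun A w hw =>
      (ae_map_iff (A.aemeasurable_jointMap w) hclosed).2 hw
    have hconv := tendsto_eLpNorm_of_tendsto hlim' (φ := fun x : E 1 => x (Sum.inl 0))
      (by fun_prop) hp0 hp (M := 1)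
      (fun i => by
        rw [← huν i]
        exact hb _ _ ((hu i 0).mono fun ω hω => (hIcc _).1 hω)) (hb B (fun _ => v) hv)
    have hle := eLpNorm_le_of_tendsto hlim' (φ := fun x : E 1 => x (Sum.inr 0)) (by fun_prop)
      (q := q) (fun i => by
        rw [← huν i, eLpNorm_inr_jointLaw]
        refine (eLpNorm_le_opNorm_mul hp0 (hA i) (u i 0)).trans_eq ?_
        rw [← eLpNorm_inl_jointLaw (A i) (u i) 0 p, huν i])
      (ENNReal.Tendsto.const_mul hconv (Or.inr hC))
    rwa [eLpNorm_inr_jointLaw, eLpNorm_inl_jointLaw] at hle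
  refine opNorm_le_of_eLpNorm_le fun v => ?_
  rcases eq_or_ne v 0 with rfl | hv0
  · rw [map_zero, eLpNorm_congr_ae (Lp.coeFn_zero ℝ 1 _), eLpNorm_zero]
    exact zero_le
  have hnorm : 0 < ‖v‖ := norm_pos_iff.2 hv0
  have h1 := hunit (‖v‖⁻¹ • v) (by
    filter_upwards [ae_abs_le_norm v, Lp.coeFn_smul ‖v‖⁻¹ v] with ω hω hω'
    rw [hω', Pi.smul_apply, smul_eq_mul, abs_mul, abs_of_pos (inv_pos.2 hnorm),
      inv_mul_le_one₀ hnorm]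
    exact hω)
  rw [map_smul, eLpNorm_congr_ae (Lp.coeFn_smul _ _), eLpNorm_congr_ae (Lp.coeFn_smul _ _),
    eLpNorm_const_smul, eLpNorm_const_smul, mul_left_comm] at h1
  exact (ENNReal.mul_le_mul_iff_right (by simpa using hnorm.ne') enorm_ne_top).1 h1

/-- Along the ultrafilter, bounded sequences of `P`-operators converge for the metric `d_M`. -/
theorem exists_tendsto_hyperfilter {A : ℕ → POperator.{u}} {p q : ℝ≥0∞} {C : ℝ≥0∞}
    (hA : ∀ n, (A n).norm p q ≤ C) (hC : C ≠ ∞) (hp0 : p ≠ 0) (hp : p ≠ ∞) (hq : 1 ≤ q) :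
    ∃ B : POperator.{u}, B.norm p q ≤ C ∧ ((∀ n, (A n).Atomless) → B.Atomless) ∧
      Tendsto A 𝒰 (𝓝 B) := by
  -- On a probability space the L¹ norm is at most the L^q norm, so the construction for p → 1
  -- applies.
  have hnorm1 : ∀ D : POperator.{u}, D.norm p q ≤ C → D.norm p 1 ≤ C := fun D hD =>
    opNorm_le_of_eLpNorm_le fun v => (eLpNorm_le_eLpNorm_of_exponent_le hq
      (Lp.aestronglyMeasurable (D.op v))).trans (eLpNorm_le_opNorm_mul hp0 hD v)
  obtain ⟨B, hBat, hto, hfrom⟩ := exists_ultralimit (fun n => hnorm1 _ (hA n)) hC hp0 hp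
  have hB : B.norm p q ≤ C := norm_le_of_tendsto_profile hA hC hp0 hp (hfrom 1)
  -- The constant sequence B shows that every sequence in a profile of B converges along 𝒰, that is,
  -- the profile is relatively compact.
  obtain ⟨_, _, hcomp, _⟩ := exists_ultralimit (A := fun _ => B) (fun _ => hnorm1 B hB) hC hp0 hp
  refine ⟨B, hB, hBat, ?_⟩
  have hprof : ∀ k, Tendsto (fun n => Metric.hausdorffDist ((A n).profile k) (B.profile k)) 𝒰
      (𝓝 0) := by
    intro k
    have hin : ∀ ε > 0, ∀ᶠ n in 𝒰, ∀ ν ∈ (A n).profile k, ∃ ν' ∈ B.profile k,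
        dist ν ν' ≤ ε := by
      intro ε hε
      by_contra hbad
      rw [← Ultrafilter.eventually_not] at hbad
      -- A counterexample wherever there is one, and an arbitrary point of the profile elsewhere.
      have hex : ∀ n, ∃ ν ∈ (A n).profile k,
          (¬ ∀ ν ∈ (A n).profile k, ∃ ν' ∈ B.profile k, dist ν ν' ≤ ε) →
            ∀ ν' ∈ B.profile k, ε < dist ν ν' := by
        intro n
        by_cases hn : ∀ ν ∈ (A n).profile k, ∃ ν' ∈ B.profile k, dist ν ν' ≤ ε
        · obtain ⟨ν, hν⟩ := (A n).profile_nonempty k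
          exact ⟨ν, hν, fun h => absurd hn h⟩
        · have hn' := hn
          push Not at hn'
          obtain ⟨ν, hν, h⟩ := hn'
          exact ⟨ν, hν, fun _ => h⟩
      choose ν hν hfar using hex
      obtain ⟨ν₀, hν₀, hlim⟩ := hto k ν hν
      obtain ⟨n, h1, h2⟩ := (hbad.and (Metric.tendsto_nhds.1 hlim ε hε)).exists
      exact lt_asymm h2 (hfar n h1 ν₀ hν₀)
    have hout : ∀ ε > 0, ∀ᶠ n in 𝒰, ∀ ν ∈ B.profile k, ∃ ν' ∈ (A n).profile k,
        dist ν ν' ≤ ε := by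
      intro ε hε
      by_contra hbad
      rw [← Ultrafilter.eventually_not] at hbad
      have hex : ∀ n, ∃ ν ∈ B.profile k,
          (¬ ∀ ν ∈ B.profile k, ∃ ν' ∈ (A n).profile k, dist ν ν' ≤ ε) →
            ∀ ν' ∈ (A n).profile k, ε < dist ν ν' := by
        intro n
        by_cases hn : ∀ ν ∈ B.profile k, ∃ ν' ∈ (A n).profile k, dist ν ν' ≤ ε
        · obtain ⟨ν, hν⟩ := B.profile_nonempty k
          exact ⟨ν, hν, fun h => absurd hn h⟩
        · have hn' := hn
          push Not at hn'
          obtain ⟨ν, hν, h⟩ := hn'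
          exact ⟨ν, hν, fun _ => h⟩
      choose ν hν hfar using hex
      obtain ⟨ν₀, -, hlim⟩ := hcomp k ν hν
      have hlim' := Metric.tendsto_nhds.1 hlim (ε / 3) (by positivity)
      -- The limit ν₀ is not known to lie in the profile of B, so a fixed nearby `ν m` from that
      -- profile is approximated instead.
      obtain ⟨m, hm⟩ := hlim'.exists
      obtain ⟨ρ, hρ, hρlim⟩ := hfrom k (ν m) (hν m)
      obtain ⟨n, h1, h2, h3⟩ :=
        (hbad.and (hlim'.and (Metric.tendsto_nhds.1 hρlim (ε / 3) (by positivity)))).exists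
      have h4 := hfar n h1 (ρ n) (hρ n)
      have h5 := dist_triangle4 (ν n) ν₀ (ν m) (ρ n)
      rw [dist_comm ν₀, dist_comm (ν m) (ρ n)] at h5
      linarith
    rw [Metric.tendsto_nhds]
    intro ε hε
    filter_upwards [hin (ε / 2) (by positivity), hout (ε / 2) (by positivity)] with n h1 h2
    rw [Real.dist_0_eq_abs, abs_of_nonneg Metric.hausdorffDist_nonneg]
    exact (Metric.hausdorffDist_le_of_mem_dist (by positivity) h1 h2).trans_lt (by linarith)
  rw [tendsto_iff_dist_tendsto_zero]
  change Tendsto (fun n => dM (A n) B) 𝒰 (𝓝 0)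
  have hsum : Summable fun k : ℕ => (1 / 2 : ℝ) ^ (k + 1) :=
    (summable_nat_add_iff 1).2 summable_geometric_two
  have := tendsto_tsum_of_dominated_convergence (𝓕 := 𝒰)
    (f := fun n k => (1 / 2 : ℝ) ^ (k + 1) *
      Metric.hausdorffDist ((A n).profile (k + 1)) (B.profile (k + 1)))
    (g := fun _ => 0) hsum (fun k => by simpa using (hprof (k + 1)).const_mul _)
    (Eventually.of_forall fun n k => by
      rw [Real.norm_of_nonneg (mul_nonneg (by positivity) Metric.hausdorffDist_nonneg)]
      exact mul_le_of_le_one_right (by positivity) (hausdorffDist_profile_le_one _ _ _))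
  simpa [dM] using this

/-- Equivalent operators have profiles with the same closure, and semicontinuity along the constant
sequence B transfers the norm bound. The bound thus holds for every representative of a class. -/
theorem norm_le_of_dM_eq_zero {A B : POperator.{u}} (h : dM A B = 0) {p q C : ℝ≥0∞}
    (hB : B.norm p q ≤ C) (hC : C ≠ ∞) (hp0 : p ≠ 0) (hp : p ≠ ∞) : A.norm p q ≤ C := by
  have hterm := (summable_dM A B).le_tsum 0 fun k _ =>
    mul_nonneg (by positivity) Metric.hausdorffDist_nonneg
  have hH : Metric.hausdorffDist (A.profile 1) (B.profile 1) ≤ 0 := by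
    change _ ≤ dM A B at hterm
    rw [h] at hterm
    norm_num at hterm
    linarith
  refine norm_le_of_tendsto_profile (ι := ℕ) (l := atTop) (A := fun _ => B) (fun _ => hB) hC hp0 hp
    fun ν₀ hν₀ => ?_
  have hex : ∀ n : ℕ, ∃ ν ∈ B.profile 1, dist ν₀ ν < 1 / ((n : ℝ) + 1) := fun n =>
    Metric.exists_dist_lt_of_hausdorffDist_lt hν₀ (hH.trans_lt (by positivity))
      (hausdorffEDist_profile_ne_top A B 1)
  choose ν hν hdist using hex
  refine ⟨ν, hν, tendsto_iff_dist_tendsto_zero.2 ?_⟩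
  refine squeeze_zero (fun _ => dist_nonneg) (fun n => ?_) tendsto_one_div_add_atTop_nhds_zero_nat
  rw [dist_comm]
  exact (hdist n).le

end POperator

/-! ### Compactness -/

/-- A limit along 𝒰 is a cluster point of the sequence, hence the limit of a subsequence, and
sequential compactness suffices in a pseudometric space. -/
theorem isCompact_of_tendsto_hyperfilter {X : Type*} [PseudoMetricSpace X] {K : Set X}
    (h : ∀ x : ℕ → X, (∀ n, x n ∈ K) → ∃ y ∈ K, Tendsto x 𝒰 (𝓝 y)) : IsCompact K := by
  refine IsSeqCompact.isCompact ?_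
  intro x hx
  obtain ⟨y, hy, hlim⟩ := h x hx
  have hcl : MapClusterPt y atTop x := hlim.mapClusterPt.mono hyperfilter_le_atTop
  obtain ⟨φ, hφ, hφlim⟩ := hcl.tendsto_subseq
  exact ⟨y, hy, φ, hφ, hφlim⟩

namespace WeakClass

theorem isCompact_bounded (c : ℝ) {p q : ℝ≥0∞} (hp0 : p ≠ 0) (hp : p ≠ ∞) (hq : 1 ≤ q) :
    IsCompact (bounded.{u} p q c) := by
  refine isCompact_of_tendsto_hyperfilter fun x hx => ?_
  choose A hAx hA using hx
  obtain ⟨B, hB, -, hlim⟩ :=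
    POperator.exists_tendsto_hyperfilter hA ENNReal.ofReal_ne_top hp0 hp hq
  exact ⟨mk B, ⟨B, rfl, hB⟩,
    ((SeparationQuotient.continuous_mk.tendsto B).comp hlim).congr hAx⟩

theorem isCompact_atomlessBounded (c : ℝ) {p q : ℝ≥0∞} (hp0 : p ≠ 0) (hp : p ≠ ∞) (hq : 1 ≤ q) :
    IsCompact (atomlessBounded.{u} p q c) := by
  refine isCompact_of_tendsto_hyperfilter fun x hx => ?_
  choose A hAx hAat using fun n => (hx n).1
  -- The atomless representative and the norm-bounded one may differ; the bound is moved to the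
  -- atomless one.
  have hA : ∀ n, (A n).norm p q ≤ ENNReal.ofReal c := by
    intro n
    obtain ⟨A', hA'x, hA'⟩ := (hx n).2
    exact POperator.norm_le_of_dM_eq_zero ((mk_eq_mk_iff _ _).1 ((hAx n).trans hA'x.symm)) hA'
      ENNReal.ofReal_ne_top hp0 hp
  obtain ⟨B, hB, hBat, hlim⟩ :=
    POperator.exists_tendsto_hyperfilter hA ENNReal.ofReal_ne_top hp0 hp hq
  exact ⟨mk B, ⟨⟨B, rfl, hBat hAat⟩, ⟨B, rfl, hB⟩⟩,
    ((SeparationQuotient.continuous_mk.tendsto B).comp hlim).congr hAx⟩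

end WeakClass

end ActionConv

end

theorem theorem2p11 (c : ℝ) (hc : 0 < c) (p q : ENNReal) (hp1 : 1 ≤ p) (hp : p ≠ ⊤)
    (hq : 1 < q) :
    CompactSpace (ActionConv.WeakClass.bounded.{u} p q c) ∧
      CompactSpace (ActionConv.WeakClass.atomlessBounded.{u} p q c) := by
  have hp0 : p ≠ 0 := (zero_lt_one.trans_le hp1).ne'
  exact ⟨isCompact_iff_compactSpace.1 (ActionConv.WeakClass.isCompact_bounded c hp0 hp hq.le),
    isCompact_iff_compactSpace.1 (ActionConv.WeakClass.isCompact_atomlessBounded c hp0 hp hq.le)⟩
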